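/- **Setting.** Let $\mathcal X$ be a real Hilbert space and $\mathcal Y_0,\dots,\mathcal Y_{I-1}$ ($I\ge 1$) uniformly smooth real Banach spaces (for instance $\mathcal X=L^2(\Omega)$, $\mathcal Y_i=L^{q/2}(\Omega)$), and let $q>2$. Let $J_{q/2}:\mathcal Y_i\to\mathcal Y_i^*$ be the duality mapping with gauge function $t\mapsto t^{q/2-1}$, i.e. $\|J_{q/2}(r)\|=\|r\|^{q/2-1}$ and $\langle J_{q/2}(r),r\rangle=\|r\|^{q/2}$. Let $\Theta:\mathcal X\to(-\infty,\infty]$ be proper, lower semicontinuous and strongly convex with modulus $c_0>0$: $$\Theta(tx+(1-t)\bar x)+c_0t(1-t)\|x-\bar x\|^2\le t\,\Theta(x)+(1-t)\,\Theta(\bar x),\qquad 0<t<1.$$ Let $D(\Theta)=\{\Theta<\infty\}$ and $D_\xi\Theta(\bar x,x)=\Theta(\bar x)-\Theta(x)-\langle\xi,\bar x-x\rangle$. Let $\xi_0\in\mathcal X$, $\sigma_0=\arg\min_\sigma\{\Theta(\sigma)-\langle\xi_0,\sigma\rangle\}$, and let $B_r(\sigma_0)$ be the open ball. The system to be solved is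 $H_i(\sigma)=y_i$, $i=0,\dots,I-1$, where $H_i$ maps a subset of $\mathcal X$ containing $B_{3\rho}(\sigma_0)$ into $\mathcal Y_i$; a *solution* satisfies all $I$ equations. **Assumptions on the operators.** There are $\rho>0$, $C_H$ and $0<\eta<1$ such that 1. the system has a solution $\sigma^\dagger\in D(\Theta)$ with $D_{\xi_0}\Theta(\sigma^\dagger,\sigma_0)\le c_0\rho^2$; 2. each $H_i$ is Fréchet differentiable on $B_{3\rho}(\sigma_0)$, with $\sigma\mapsto H_i'(\sigma)$ continuous there; 3. $\|H_i'(\sigma)\|\le C_H$ and $\|H_i(\sigma)-H_i(\bar\sigma)-H_i'(\bar\sigma)(\sigma-\bar\sigma)\|\le\eta\|H_i(\sigma)-H_i(\bar\sigma)\|$ for all $\sigma,\bar\sigma\in B_{3\rho}(\sigma_0)$. **Method.** Let $\tau>1$, $\bar\mu_0,\bar\mu_1>0$ be such that $$c_1:=1-\eta-\frac{1+\eta}{\tau}-\frac{\bar\mu_0}{4c_0}>0 .$$ For every $\delta>0$ let $y_i^\delta\in\mathcal Y_i$ with $\|y_i-y_i^\delta\|\le\delta$ for all $i$. Given combination parameters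 $\lambda_{n,i}^\delta\ge 0$, start with $\xi_{0,0}^\delta=\xi_{0,-1}^\delta=\xi_0$ and for $n\ge 0$, $0\le i\le I-1$ put $$\zeta_{n,i}^\delta=\xi_{n,i}^\delta+\lambda_{n,i}^\delta(\xi_{n,i}^\delta-\xi_{n,i-1}^\delta),\quad z_{n,i}^\delta=\arg\min_\sigma\{\Theta(\sigma)-\langle\zeta_{n,i}^\delta,\sigma\rangle\},\quad r_{n,i}^\delta=H_i(z_{n,i}^\delta)-y_i^\delta,$$ $$\xi_{n,i+1}^\delta=\zeta_{n,i}^\delta-\mu_{n,i}^\delta g_{n,i}^\delta,\qquad g_{n,i}^\delta=H_i'(z_{n,i}^\delta)^*J_{q/2}(r_{n,i}^\delta),\qquad \sigma_{n,i}^\delta=\arg\min_\sigma\{\Theta(\sigma)-\langle\xi_{n,i}^\delta,\sigma\rangle\},$$ $$\mu_{n,i}^\delta=\begin{cases}\min\Big\{\dfrac{\bar\mu_0\|r_{n,i}^\delta\|^{2(q/2-1)}}{\|g_{n,i}^\delta\|^2},\ \bar\mu_1\Big\}\|r_{n,i}^\delta\|^{2-q/2},&\|r_{n,i}^\delta\|>\tau\delta,\\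 0,&\|r_{n,i}^\delta\|\le\tau\delta,\end{cases}$$ (the quotient is $\infty$ if $g_{n,i}^\delta=0$), with $\xi_{n+1,0}^\delta=\xi_{n,I}^\delta$ and $\xi_{n+1,-1}^\delta=\xi_{n,I-1}^\delta$. Write $\xi_n^\delta=\xi_{n,0}^\delta$, $\sigma_n^\delta=\sigma_{n,0}^\delta$, and let $n_\delta$ be the first $n$ with $\mu_{n,i}^\delta=0$ for all $i=0,\dots,I-1$. **Assumptions on the combination parameters.** With a constant $\nu>1$ independent of $\delta$ and $n$, for all $\delta>0$, $n$ and $i$, $$\frac{(\lambda_{n,i}^\delta)^2+\lambda_{n,i}^\delta}{4c_0}\|\xi_{n,i}^\delta-\xi_{n,i-1}^\delta\|^2\le c_0\rho^2,\qquad \frac{(\lambda_{n,i}^\delta)^2+\lambda_{n,i}^\delta}{4c_0}\|\xi_{n,i}^\delta-\xi_{n,i-1}^\delta\|^2-\frac{c_1}{\nu}\mu_{n,i}^\delta\|r_{n,i}^\delta\|^{q/2}\le 0 .$$ Moreover there are parameters $\lambda_{n,i}$ such that, with $\xi_{n,i}$ denoting the iterates of the same method run with exact data $y_i$, with $\delta=0$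 and with the $\lambda_{n,i}$: for each $(n,i)$, $\lambda_{n,i}^\delta$ stays bounded as $\delta\to0$, and $\lambda_{n,i}^\delta\to\lambda_{n,i}$ as $\delta\to 0$ whenever $\xi_{n,i}\ne\xi_{n,i-1}$; and $$\sum_{n=0}^\infty\sum_{i=0}^{I-1}\lambda_{n,i}\|\xi_{n,i}-\xi_{n,i-1}\|<\infty .$$ **Conclusion.** For every $\delta>0$ the index $n_\delta$ exists (is finite), and there is a solution $\sigma^*\in B_{2\rho}(\sigma_0)\cap D(\Theta)$ such that $$\lim_{\delta\to 0}\|\sigma_{n_\delta}^\delta-\sigma^*\|=0,\qquad \lim_{\delta\to 0}D_{\xi_{n_\delta}^\delta}\Theta(\sigma^*,\sigma_{n_\delta}^\delta)=0 .$$ -/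

import Mathlib

open Filter Topology

noncomputable section

section ConvexAnalysis

variable {X : Type*} [NormedAddCommGroup X] [InnerProductSpace ℝ X]

/-- A functional with values in `(-∞, ∞]` that is not identically `∞`. -/
def ProperFun (Θ : X → EReal) : Prop :=
  (∀ x, Θ x ≠ ⊥) ∧ ∃ x, Θ x ≠ ⊤

/-- Strong convexity with modulus `c₀`:
`Θ (t x + (1 - t) y) + c₀ t (1 - t) ‖x - y‖² ≤ t Θ x + (1 - t) Θ y` for `0 < t < 1`. -/
def StronglyConvexFun (c₀ : ℝ) (Θ : X → EReal) : Prop :=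
  ∀ x y : X, ∀ t : ℝ, 0 < t → t < 1 →
    Θ (t • x + (1 - t) • y) + ((c₀ * t * (1 - t) * ‖x - y‖ ^ 2 : ℝ) : EReal)
      ≤ (t : EReal) * Θ x + ((1 - t : ℝ) : EReal) * Θ y

/-- The effective domain `D(Θ)`. -/
def effDom (Θ : X → EReal) : Set X := {x | Θ x < ⊤}

/-- The Bregman distance `D_ξ Θ(x', x) = Θ x' - Θ x - ⟨ξ, x' - x⟩`. -/
def bregmanDist (Θ : X → EReal) (ξ x' x : X) : EReal :=
  Θ x' - Θ x - ((inner ℝ ξ (x' - x) : ℝ) : EReal)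

/-- `x` minimizes `Θ(·) - ⟨ξ, ·⟩` over `X`. -/
def IsTiltedMin (Θ : X → EReal) (ξ x : X) : Prop :=
  ∀ w : X, Θ x - ((inner ℝ ξ x : ℝ) : EReal) ≤ Θ w - ((inner ℝ ξ w : ℝ) : EReal)

/-- `arg min {Θ(·) - ⟨ξ, ·⟩}`; the minimizer exists and is unique when `Θ` is proper, lower
semicontinuous and strongly convex and `X` is complete. -/
def argminTilt (Θ : X → EReal) (ξ : X) : X :=
  Classical.epsilon (IsTiltedMin Θ ξ)

end ConvexAnalysis

section Duality

variable {Y : Type*} [NormedAddCommGroup Y] [NormedSpace ℝ Y]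

/-- Uniform smoothness of a normed space: the modulus of smoothness is `o(t)` as `t → 0`. -/
def UniformlySmooth (Y : Type*) [NormedAddCommGroup Y] [NormedSpace ℝ Y] : Prop :=
  ∀ ε : ℝ, 0 < ε → ∃ t : ℝ, 0 < t ∧ ∀ x h : Y, ‖x‖ = 1 → ‖h‖ ≤ t →
    ‖x + h‖ + ‖x - h‖ ≤ 2 + ε * ‖h‖

/-- The duality mapping `J_p : Y → Y*` with gauge function `t ↦ t ^ (p - 1)`; it is single valued
when `Y` is uniformly smooth. -/
def dualityMap (p : ℝ) (y : Y) : StrongDual ℝ Y :=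
  Classical.epsilon fun f : StrongDual ℝ Y => ‖f‖ = ‖y‖ ^ (p - 1) ∧ f y = ‖y‖ ^ p

end Duality

/-- The data on which the two-point-gradient method of Kaczmarz type runs, apart from the
measurements and the combination parameters: the penalty `Θ`, the operators `H i`, the initial
`ξ₀`, the exponent `q` and the constants `τ`, `μ₀`, `μ₁` of the step size rule. -/
structure TPGSetup (X : Type*) {I : ℕ} (Y : Fin I → Type*) where
  Θ : X → EReal
  H : ∀ i, X → Y i
  ξ₀ : X
  q : ℝ
  τ : ℝ
  μ₀ : ℝ
  μ₁ : ℝ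

namespace TPGSetup

variable {X : Type*} [NormedAddCommGroup X] [InnerProductSpace ℝ X] [CompleteSpace X]
  {I : ℕ} [NeZero I] {Y : Fin I → Type*} [∀ i, NormedAddCommGroup (Y i)]
  [∀ i, NormedSpace ℝ (Y i)]

/-- The initial guess `σ₀ = arg min {Θ(·) - ⟨ξ₀, ·⟩}`. -/
def σ₀ (S : TPGSetup X Y) : X := argminTilt S.Θ S.ξ₀

/-- `H i'(x)* J_{q/2}(r)`, as an element of the Hilbert space `X`. -/
def adjDual (S : TPGSetup X Y) (i : Fin I) (x : X) (r : Y i) : X :=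
  (InnerProductSpace.toDual ℝ X).symm ((dualityMap (S.q / 2) r).comp (fderiv ℝ (S.H i) x))

/-- The step size as a function of the noise level `δ`, the residual `r` and
`g = H i'(z)* J_{q/2}(r)`; the quotient in the minimum is read as `∞` when `g = 0`. -/
def stepSize (S : TPGSetup X Y) (δ : ℝ) {i : Fin I} (r : Y i) (g : X) : ℝ :=
  open Classical in
  if S.τ * δ < ‖r‖ then
    (if g = 0 then S.μ₁ else min (S.μ₀ * ‖r‖ ^ (2 * (S.q / 2 - 1)) / ‖g‖ ^ 2) S.μ₁)
      * ‖r‖ ^ (2 - S.q / 2)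
  else 0

/-- One inner step with equation `i` and combination parameter `l`: it sends the pair
`(ξ_{n,i}, ξ_{n,i-1})` to the pair `(ξ_{n,i+1}, ξ_{n,i})`. -/
def step (S : TPGSetup X Y) (data : ∀ i, Y i) (δ : ℝ) (i : Fin I) (l : ℝ) (s : X × X) : X × X :=
  let ζ := s.1 + l • (s.1 - s.2)
  let z := argminTilt S.Θ ζ
  let r := S.H i z - data i
  let g := S.adjDual i z r
  (ζ - S.stepSize δ r g • g, s.1)

/-- The pairs `(ξ_{n,i}, ξ_{n,i-1})`, listed consecutively: the pair with index `(n, i)` has number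
`n * I + i`. So `ξ_{n,I} = ξ_{n+1,0}` and `ξ_{n,I-1} = ξ_{n+1,-1}`; the start is
`ξ_{0,0} = ξ_{0,-1} = ξ₀`. -/
def iter (S : TPGSetup X Y) (data : ∀ i, Y i) (δ : ℝ) (lam : ℕ → Fin I → ℝ) : ℕ → X × X
  | 0 => (S.ξ₀, S.ξ₀)
  | m + 1 => S.step data δ (Fin.ofNat I m) (lam (m / I) (Fin.ofNat I m)) (S.iter data δ lam m)

/-- `ξ_{n,i}`, for `0 ≤ i ≤ I`; in particular `ξ_n = ξ_{n,0}`. -/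
def xi (S : TPGSetup X Y) (data : ∀ i, Y i) (δ : ℝ) (lam : ℕ → Fin I → ℝ) (n i : ℕ) : X :=
  (S.iter data δ lam (n * I + i)).1

/-- The momentum `ξ_{n,i} - ξ_{n,i-1}`. -/
def momentum (S : TPGSetup X Y) (data : ∀ i, Y i) (δ : ℝ) (lam : ℕ → Fin I → ℝ) (n i : ℕ) : X :=
  (S.iter data δ lam (n * I + i)).1 - (S.iter data δ lam (n * I + i)).2

/-- `σ_{n,i} = arg min {Θ(·) - ⟨ξ_{n,i}, ·⟩}`; in particular `σ_n = σ_{n,0}`. -/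
def sigma (S : TPGSetup X Y) (data : ∀ i, Y i) (δ : ℝ) (lam : ℕ → Fin I → ℝ) (n i : ℕ) : X :=
  argminTilt S.Θ (S.xi data δ lam n i)

/-- `ζ_{n,i} = ξ_{n,i} + λ_{n,i} (ξ_{n,i} - ξ_{n,i-1})`. -/
def zeta (S : TPGSetup X Y) (data : ∀ i, Y i) (δ : ℝ) (lam : ℕ → Fin I → ℝ) (n : ℕ)
    (i : Fin I) : X :=
  S.xi data δ lam n i + lam n i • S.momentum data δ lam n i

/-- `z_{n,i} = arg min {Θ(·) - ⟨ζ_{n,i}, ·⟩}`. -/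
def z (S : TPGSetup X Y) (data : ∀ i, Y i) (δ : ℝ) (lam : ℕ → Fin I → ℝ) (n : ℕ)
    (i : Fin I) : X :=
  argminTilt S.Θ (S.zeta data δ lam n i)

/-- The residual `r_{n,i} = H i (z_{n,i}) - data i`. -/
def residual (S : TPGSetup X Y) (data : ∀ i, Y i) (δ : ℝ) (lam : ℕ → Fin I → ℝ) (n : ℕ)
    (i : Fin I) : Y i :=
  S.H i (S.z data δ lam n i) - data i

/-- The step size `μ_{n,i}`. -/
def mu (S : TPGSetup X Y) (data : ∀ i, Y i) (δ : ℝ) (lam : ℕ → Fin I → ℝ) (n : ℕ)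
    (i : Fin I) : ℝ :=
  S.stepSize δ (S.residual data δ lam n i)
    (S.adjDual i (S.z data δ lam n i) (S.residual data δ lam n i))

/-- The indices at which the stopping criterion holds: `μ_{n,i} = 0` for all `i`. The iteration
is stopped at the least of them. -/
def stopSet (S : TPGSetup X Y) (data : ∀ i, Y i) (δ : ℝ) (lam : ℕ → Fin I → ℝ) : Set ℕ :=
  {n | ∀ i, S.mu data δ lam n i = 0}

/-- `c₁ = 1 - η - (1 + η) / τ - μ₀ / (4 c₀)`. -/
def c₁ (S : TPGSetup X Y) (c₀ η : ℝ) : ℝ :=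
  1 - η - (1 + η) / S.τ - S.μ₀ / (4 * c₀)

/-- The standing assumption on the operators, with exact data `y`, strong convexity modulus `c₀`,
radius `ρ`, derivative bound `C` and tangential cone constant `η`. -/
structure OperatorAssumption (S : TPGSetup X Y) (y : ∀ i, Y i) (c₀ ρ C η : ℝ) : Prop where
  rho_pos : 0 < ρ
  exists_solution : ∃ σd ∈ effDom S.Θ, (∀ i, S.H i σd = y i) ∧
    bregmanDist S.Θ S.ξ₀ σd S.σ₀ ≤ ((c₀ * ρ ^ 2 : ℝ) : EReal)
  differentiable : ∀ i, ∀ x ∈ Metric.ball S.σ₀ (3 * ρ), DifferentiableAt ℝ (S.H i) x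
  continuous_deriv : ∀ i, ContinuousOn (fderiv ℝ (S.H i)) (Metric.ball S.σ₀ (3 * ρ))
  eta_pos : 0 < η
  eta_lt_one : η < 1
  deriv_bound : ∀ i, ∀ x ∈ Metric.ball S.σ₀ (3 * ρ), ‖fderiv ℝ (S.H i) x‖ ≤ C
  tangential_cone : ∀ i, ∀ x ∈ Metric.ball S.σ₀ (3 * ρ), ∀ x' ∈ Metric.ball S.σ₀ (3 * ρ),
    ‖S.H i x - S.H i x' - fderiv ℝ (S.H i) x' (x - x')‖ ≤ η * ‖S.H i x - S.H i x'‖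

/-- The two requirements on the (nonnegative) combination parameters of a run; the second one
carries the constants `c₁` and `ν`. -/
structure AdmissibleParams (S : TPGSetup X Y) (data : ∀ i, Y i) (δ : ℝ) (lam : ℕ → Fin I → ℝ)
    (c₀ ρ c₁ ν : ℝ) : Prop where
  nonneg : ∀ n i, 0 ≤ lam n i
  le_radius : ∀ n (i : Fin I),
    (lam n i ^ 2 + lam n i) / (4 * c₀) * ‖S.momentum data δ lam n i‖ ^ 2 ≤ c₀ * ρ ^ 2
  le_residual : ∀ n (i : Fin I),
    (lam n i ^ 2 + lam n i) / (4 * c₀) * ‖S.momentum data δ lam n i‖ ^ 2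
      - c₁ / ν * S.mu data δ lam n i * ‖S.residual data δ lam n i‖ ^ (S.q / 2) ≤ 0

end TPGSetup

end

/-! Progress is measured by the Bregman distance `bregReal S.Θ ξ w` to a solution `w` in the ball of
radius `3ρ`. Strong convexity yields `bregReal_le`: replacing `ξ` by `ξ'` changes this distance by
at most `‖ξ' - ξ‖² / (4c₀) - ⟨ξ' - ξ, w - x⟩`, where `x` is the minimizer belonging to `ξ`. For the
gradient part of a step, the tangential cone condition and `‖r‖ > τδ` turn this into a decrease by
`c₁ μ ‖r‖^(q/2)` (`bregReal_gradient_step_le`). Extrapolation may increase the distance, but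
admissibility limits the increase to the fraction `1/ν` of that decrease
(`bregReal_momentum_step_le`, `bregReal_decrease`). Hence the distance is nonincreasing, all `z`
stay in the ball, and the sum of `μ ‖r‖^(q/2)` converges. With noise every active equation
contributes at least a constant times `(τδ)²`, so the run stops, and from then on it is stationary.

For exact data the squares of the residual sums `R n` are summable. Along record indices `k`, where
`R k ≤ R n` for all `n ≤ k`, the pairing of `ξ_k - ξ_l` with `σ_k - w` telescopes into terms
dominated by the momentum series and by `R n ^ 2`. Its bound is the tail of a convergent series, so
the `σ_k` form a Cauchy sequence along the records (`exists_bregReal_sigma_le`). The limit `σs`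
solves the system because `R` tends to zero. Lower semicontinuity makes the Bregman distance to `σs`
vanish along the records, and monotonicity extends this to the whole run
(`exists_tendsto_bregReal`).

Finally, for fixed `n` the noisy iterate tends to the exact one (`tendsto_iter`); uniform smoothness
enters here through continuity of the duality mapping. By monotonicity and stationarity the distance
to `σs` at the stopping index is at most the distance at any index `n` (`bregReal_stop_le`).
Choosing `n` with a small exact distance and then `δ` small finishes the proof, whether or not the
stopping index tends to infinity. -/

set_option linter.unusedSectionVars false

/-! ### Strongly convex functionals: tilted minimizers and Bregman distances. -/

section ConvexAnalysis

variable {X : Type*} [NormedAddCommGroup X] [InnerProductSpace ℝ X]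

/-- Proper, lower semicontinuous and strongly convex functionals with modulus `c₀ > 0`. -/
structure IsPenalty (c₀ : ℝ) (Θ : X → EReal) : Prop where
  pos : 0 < c₀
  proper : ProperFun Θ
  lsc : LowerSemicontinuous Θ
  conv : StronglyConvexFun c₀ Θ

/-- The Bregman distance `D_ξ Θ(w, x)` at the minimizer `x` of `Θ - ⟨ξ, ·⟩`, as a real number. -/
noncomputable def bregReal (Θ : X → EReal) (ξ w : X) : ℝ :=
  (Θ w).toReal - (Θ (argminTilt Θ ξ)).toReal - inner ℝ ξ (w - argminTilt Θ ξ)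

namespace IsPenalty

variable {c₀ : ℝ} {Θ : X → EReal}

theorem coe_toReal (h : IsPenalty c₀ Θ) {x : X} (hx : x ∈ effDom Θ) :
    (((Θ x).toReal : ℝ) : EReal) = Θ x :=
  EReal.coe_toReal (ne_of_lt hx) (h.proper.1 x)

theorem effDom_nonempty (h : IsPenalty c₀ Θ) : (effDom Θ).Nonempty := by
  obtain ⟨x, hx⟩ := h.proper.2
  exact ⟨x, lt_top_iff_ne_top.2 hx⟩

theorem convex_real (h : IsPenalty c₀ Θ) {x y : X} (hx : x ∈ effDom Θ) (hy : y ∈ effDom Θ)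
    {t : ℝ} (ht : 0 < t) (ht' : t < 1) :
    t • x + (1 - t) • y ∈ effDom Θ ∧
      (Θ (t • x + (1 - t) • y)).toReal + c₀ * t * (1 - t) * ‖x - y‖ ^ 2
        ≤ t * (Θ x).toReal + (1 - t) * (Θ y).toReal := by
  have key := h.conv x y t ht ht'
  rw [← h.coe_toReal hx, ← h.coe_toReal hy, ← EReal.coe_mul, ← EReal.coe_mul,
    ← EReal.coe_add] at key
  have hmem : t • x + (1 - t) • y ∈ effDom Θ := by
    change Θ (t • x + (1 - t) • y) < ⊤
    refine Ne.lt_top fun htop => ?_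
    rw [htop, EReal.top_add_coe] at key
    exact absurd (top_le_iff.1 key) (EReal.coe_ne_top _)
  refine ⟨hmem, ?_⟩
  rw [← h.coe_toReal hmem, ← EReal.coe_add] at key
  exact_mod_cast key

/-- Lower semicontinuity in real-valued form. Finiteness at the limit is part of the conclusion,
since `toReal` alone would not detect the value `⊤`. -/
theorem mem_and_le_of_tendsto (h : IsPenalty c₀ Θ) {ι : Type*} {l : Filter ι} [l.NeBot]
    {u : ι → X} {x : X} (hu : Tendsto u l (𝓝 x)) (ξ : X) (B : ℝ)
    (hB : ∀ᶠ k in l, u k ∈ effDom Θ ∧ (Θ (u k)).toReal - inner ℝ ξ (u k) ≤ B) :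
    x ∈ effDom Θ ∧ (Θ x).toReal - inner ℝ ξ x ≤ B := by
  have hinner : Tendsto (fun k => (inner ℝ ξ (u k) : ℝ)) l (𝓝 (inner ℝ ξ x)) :=
    tendsto_const_nhds.inner hu
  have hle : ∀ a : ℝ, (a : EReal) < Θ x → a ≤ B + inner ℝ ξ x := by
    intro a ha
    have h1 : ∀ᶠ k in l, (a : EReal) < Θ (u k) := hu.eventually (h.lsc x a ha)
    refine ge_of_tendsto (tendsto_const_nhds.add hinner) ?_
    filter_upwards [h1, hB] with k hk hk'
    rw [← h.coe_toReal hk'.1] at hk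
    have := EReal.coe_lt_coe_iff.1 hk
    linarith [hk'.2]
  have hx : Θ x ≤ ((B + inner ℝ ξ x : ℝ) : EReal) := by
    by_contra hcon
    obtain ⟨a, ha, ha'⟩ := EReal.lt_iff_exists_real_btwn.1 (not_le.1 hcon)
    exact absurd (hle a ha') (not_le.2 (EReal.coe_lt_coe_iff.1 ha))
  have hmem : x ∈ effDom Θ := lt_of_le_of_lt hx (EReal.coe_lt_top _)
  refine ⟨hmem, ?_⟩
  rw [← h.coe_toReal hmem] at hx
  linarith [EReal.coe_le_coe_iff.1 hx]

theorem tilt_convex (h : IsPenalty c₀ Θ) (ξ : X) {x y : X} (hx : x ∈ effDom Θ)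
    (hy : y ∈ effDom Θ) {t : ℝ} (ht : 0 < t) (ht' : t < 1) :
    t • x + (1 - t) • y ∈ effDom Θ ∧
      (Θ (t • x + (1 - t) • y)).toReal - inner ℝ ξ (t • x + (1 - t) • y)
          + c₀ * t * (1 - t) * ‖x - y‖ ^ 2
        ≤ t * ((Θ x).toReal - inner ℝ ξ x) + (1 - t) * ((Θ y).toReal - inner ℝ ξ y) := by
  obtain ⟨h1, h2⟩ := h.convex_real hx hy ht ht'
  refine ⟨h1, ?_⟩
  rw [inner_add_right, inner_smul_right, inner_smul_right]
  linarith

/-- Lower semicontinuity bounds the tilted functional below near one point `x₀`. Strong convexity on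
the segment from `x₀` to `x` carries the bound to every `x`: the quadratic gain outweighs the linear
loss of the extrapolation. -/
theorem tilt_bddBelow (h : IsPenalty c₀ Θ) (ξ : X) :
    ∃ b : ℝ, ∀ x ∈ effDom Θ, b ≤ (Θ x).toReal - inner ℝ ξ x := by
  obtain ⟨x₀, hx₀⟩ := h.effDom_nonempty
  set F : X → ℝ := fun x => (Θ x).toReal - inner ℝ ξ x with hF
  have hlt : (((Θ x₀).toReal - 1 / 2 : ℝ) : EReal) < Θ x₀ := by
    conv_rhs => rw [← h.coe_toReal hx₀]
    exact EReal.coe_lt_coe_iff.2 (by linarith)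
  have h1 : ∀ᶠ x in 𝓝 x₀, (((Θ x₀).toReal - 1 / 2 : ℝ) : EReal) < Θ x := h.lsc x₀ _ hlt
  have h2 : ∀ᶠ x in 𝓝 x₀, (inner ℝ ξ x : ℝ) < inner ℝ ξ x₀ + 1 / 2 := by
    have : Tendsto (fun x => (inner ℝ ξ x : ℝ)) (𝓝 x₀) (𝓝 (inner ℝ ξ x₀)) :=
      tendsto_const_nhds.inner tendsto_id
    exact this.eventually_lt_const (by linarith)
  obtain ⟨r, hr, hball⟩ := Metric.eventually_nhds_iff.1 (h1.and h2)
  have hloc : ∀ x ∈ effDom Θ, dist x x₀ < r → F x₀ - 1 ≤ F x := by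
    intro x hx hd
    obtain ⟨ha, hb⟩ := hball hd
    rw [← h.coe_toReal hx] at ha
    have := EReal.coe_lt_coe_iff.1 ha
    simp only [hF]
    linarith
  -- The loss `2 / (c₀ r²)` comes from completing the square in `c₀ d² / 2 - 2 d / r`, with `d` the
  -- distance from `x` to `x₀`.
  refine ⟨F x₀ - 1 - 2 / (c₀ * r ^ 2), fun x hx => ?_⟩
  have hc := h.pos
  have hq : 0 < 2 / (c₀ * r ^ 2) := by positivity
  by_cases hd : dist x x₀ < r
  · have := hloc x hx hd
    simp only [hF] at this ⊢
    linarith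
  · have hd' : r ≤ ‖x - x₀‖ := by rw [← dist_eq_norm]; exact not_lt.1 hd
    set d := ‖x - x₀‖ with hdd
    have hdpos : 0 < d := lt_of_lt_of_le hr hd'
    -- This `t` puts the convex combination at distance `r / 2` from `x₀`, where the local bound
    -- applies, and keeps `1 - t ≥ 1 / 2`.
    set t := r / (2 * d) with ht
    have htpos : 0 < t := by positivity
    have htd : t * d = r / 2 := by rw [ht]; field_simp
    have hthalf : t ≤ 1 / 2 := by
      rw [ht, div_le_div_iff₀ (by positivity) (by norm_num)]
      linarith
    obtain ⟨hm, hcv⟩ := h.tilt_convex ξ hx hx₀ htpos (by linarith)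
    have hdist : dist (t • x + (1 - t) • x₀) x₀ < r := by
      have : t • x + (1 - t) • x₀ - x₀ = t • (x - x₀) := by module
      rw [dist_eq_norm, this, norm_smul, Real.norm_of_nonneg htpos.le, htd]
      linarith
    have hl := hloc _ hm hdist
    simp only [hF] at hl ⊢
    set A := (Θ x₀).toReal - inner ℝ ξ x₀
    set E := (Θ x).toReal - inner ℝ ξ x
    have h3 : A - 1 + c₀ * t * (1 - t) * d ^ 2 ≤ t * E + (1 - t) * A := by linarith
    have h4 : c₀ * t * (1 / 2) * d ^ 2 ≤ c₀ * t * (1 - t) * d ^ 2 := by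
      gcongr
      linarith
    have h5 : t * (A + c₀ * (1 / 2) * d ^ 2 - 2 * d / r) ≤ t * E := by
      have : t * (2 * d / r) = 1 := by
        rw [ht]; field_simp
      nlinarith
    have h6 := le_of_mul_le_mul_left h5 htpos
    have h7 : 2 * d / r ≤ c₀ * (1 / 2) * d ^ 2 + 2 / (c₀ * r ^ 2) := by
      have e : c₀ * (1 / 2) * d ^ 2 + 2 / (c₀ * r ^ 2) - 2 * d / r
          = (c₀ * r * d - 2) ^ 2 / (2 * c₀ * r ^ 2) := by
        field_simp
        ring
      have : 0 ≤ (c₀ * r * d - 2) ^ 2 / (2 * c₀ * r ^ 2) := by positivity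
      linarith
    linarith

/-- Direct method without weak compactness: strong convexity at midpoints makes a minimizing
sequence Cauchy in norm, and lower semicontinuity identifies its limit as a minimizer. -/
theorem exists_isTiltedMin [CompleteSpace X] (h : IsPenalty c₀ Θ) (ξ : X) :
    ∃ x, IsTiltedMin Θ ξ x := by
  obtain ⟨b, hb⟩ := h.tilt_bddBelow ξ
  set F : X → ℝ := fun x => (Θ x).toReal - inner ℝ ξ x with hF
  have hne : (F '' effDom Θ).Nonempty := h.effDom_nonempty.image F
  have hbdd : BddBelow (F '' effDom Θ) := ⟨b, by rintro _ ⟨x, hx, rfl⟩; exact hb x hx⟩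
  set m := sInf (F '' effDom Θ) with hm
  have hmle : ∀ x ∈ effDom Θ, m ≤ F x := fun x hx => csInf_le hbdd ⟨x, hx, rfl⟩
  have hex : ∀ k : ℕ, ∃ x ∈ effDom Θ, F x < m + 1 / ((k : ℝ) + 1) := by
    intro k
    obtain ⟨_, ⟨x, hx, rfl⟩, hlt⟩ := exists_lt_of_csInf_lt hne
      (show m < m + 1 / ((k : ℝ) + 1) by linarith [Nat.one_div_pos_of_nat (α := ℝ) (n := k)])
    exact ⟨x, hx, hlt⟩
  choose u hu hFu using hex
  have hc := h.pos
  have hcau : ∀ N k l : ℕ, N ≤ k → N ≤ l → c₀ / 4 * ‖u k - u l‖ ^ 2 ≤ 1 / ((N : ℝ) + 1) := by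
    intro N k l hk hl
    obtain ⟨h1, h2⟩ := h.tilt_convex ξ (hu k) (hu l) (t := 1 / 2) (by norm_num) (by norm_num)
    have h3 := hmle _ h1
    have h4 := Nat.one_div_le_one_div (α := ℝ) hk
    have h5 := Nat.one_div_le_one_div (α := ℝ) hl
    have h6 := hFu k
    have h7 := hFu l
    simp only [hF] at h3 h6 h7
    linarith
  have hC : CauchySeq u := by
    refine Metric.cauchySeq_iff.2 fun ε hε => ?_
    obtain ⟨N, hN⟩ := exists_nat_one_div_lt (show 0 < c₀ / 4 * ε ^ 2 by positivity)
    refine ⟨N, fun k hk l hl => ?_⟩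
    have h1 := lt_of_le_of_lt (hcau N k l hk hl) hN
    rw [dist_eq_norm]
    exact lt_of_pow_lt_pow_left₀ 2 hε.le (lt_of_mul_lt_mul_left h1 (by positivity))
  obtain ⟨x, hx⟩ := cauchySeq_tendsto_of_complete hC
  have hfin : ∀ N : ℕ, x ∈ effDom Θ ∧ F x ≤ m + 1 / ((N : ℝ) + 1) := by
    intro N
    refine h.mem_and_le_of_tendsto hx ξ _ ?_
    filter_upwards [eventually_ge_atTop N] with k hk
    exact ⟨hu k, (hFu k).le.trans (by linarith [Nat.one_div_le_one_div (α := ℝ) hk])⟩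
  have hxm : F x ≤ m :=
    le_of_forall_pos_le_add fun ε hε => by
      obtain ⟨N, hN⟩ := exists_nat_one_div_lt hε
      linarith [(hfin N).2]
  refine ⟨x, fun w => ?_⟩
  by_cases hw : w ∈ effDom Θ
  · rw [← h.coe_toReal hw, ← h.coe_toReal (hfin 0).1, ← EReal.coe_sub, ← EReal.coe_sub]
    exact EReal.coe_le_coe_iff.2 (hxm.trans (hmle w hw))
  · have : Θ w = ⊤ := not_lt_top_iff.1 hw
    rw [this, EReal.top_sub_coe]
    exact le_top

/-- The three-point identity. It is purely algebraic and needs neither minimality nor `w` in the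
effective domain. -/
theorem bregReal_sub_eq (ξ ξ' w : X) :
    bregReal Θ ξ' w - bregReal Θ ξ w
      = bregReal Θ ξ' (argminTilt Θ ξ) - inner ℝ (ξ' - ξ) (w - argminTilt Θ ξ) := by
  simp only [bregReal, inner_sub_left, inner_sub_right]
  ring

theorem bregReal_add_symm (ξ ξ' : X) :
    bregReal Θ ξ' (argminTilt Θ ξ) + bregReal Θ ξ (argminTilt Θ ξ')
      = inner ℝ (ξ' - ξ) (argminTilt Θ ξ' - argminTilt Θ ξ) := by
  simp only [bregReal, inner_sub_left, inner_sub_right]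
  ring

theorem mem_and_bregReal_le_of_tendsto (h : IsPenalty c₀ Θ) {ι : Type*} {l : Filter ι} [l.NeBot]
    {u : ι → X} {x : X} (hu : Tendsto u l (𝓝 x)) (ξ : X) (B : ℝ)
    (hB : ∀ᶠ k in l, u k ∈ effDom Θ ∧ bregReal Θ ξ (u k) ≤ B) :
    x ∈ effDom Θ ∧ bregReal Θ ξ x ≤ B := by
  have := h.mem_and_le_of_tendsto hu ξ
    (B + (Θ (argminTilt Θ ξ)).toReal - inner ℝ ξ (argminTilt Θ ξ)) (by
      filter_upwards [hB] with k hk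
      refine ⟨hk.1, ?_⟩
      have := hk.2
      rw [bregReal, inner_sub_right] at this
      linarith)
  refine ⟨this.1, ?_⟩
  have h2 := this.2
  rw [bregReal, inner_sub_right]
  linarith

variable [CompleteSpace X]

theorem isTiltedMin_argminTilt (h : IsPenalty c₀ Θ) (ξ : X) :
    IsTiltedMin Θ ξ (argminTilt Θ ξ) :=
  Classical.epsilon_spec (h.exists_isTiltedMin ξ)

theorem argminTilt_mem (h : IsPenalty c₀ Θ) (ξ : X) : argminTilt Θ ξ ∈ effDom Θ := by
  obtain ⟨w, hw⟩ := h.effDom_nonempty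
  have key := h.isTiltedMin_argminTilt ξ w
  change Θ (argminTilt Θ ξ) < ⊤
  refine Ne.lt_top fun htop => ?_
  rw [htop, ← h.coe_toReal hw, EReal.top_sub_coe, ← EReal.coe_sub] at key
  exact absurd (top_le_iff.1 key) (EReal.coe_ne_top _)

theorem argminTilt_le (h : IsPenalty c₀ Θ) (ξ : X) {w : X} (hw : w ∈ effDom Θ) :
    (Θ (argminTilt Θ ξ)).toReal - inner ℝ ξ (argminTilt Θ ξ)
      ≤ (Θ w).toReal - inner ℝ ξ w := by
  have key := h.isTiltedMin_argminTilt ξ w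
  rw [← h.coe_toReal hw, ← h.coe_toReal (h.argminTilt_mem ξ), ← EReal.coe_sub,
    ← EReal.coe_sub] at key
  exact EReal.coe_le_coe_iff.1 key

theorem bregmanDist_eq (h : IsPenalty c₀ Θ) (ξ : X) {w : X} (hw : w ∈ effDom Θ) :
    bregmanDist Θ ξ w (argminTilt Θ ξ) = (bregReal Θ ξ w : EReal) := by
  rw [bregmanDist, bregReal, ← h.coe_toReal hw, ← h.coe_toReal (h.argminTilt_mem ξ),
    ← EReal.coe_sub, ← EReal.coe_sub]
  simp

/-- Compare the minimizer with the point at parameter `t` on the segment towards `w`, divide by `t`,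
and let `t` tend to zero. -/
theorem norm_sq_le_bregReal (h : IsPenalty c₀ Θ) (ξ : X) {w : X} (hw : w ∈ effDom Θ) :
    c₀ * ‖w - argminTilt Θ ξ‖ ^ 2 ≤ bregReal Θ ξ w := by
  set x := argminTilt Θ ξ with hx
  have key : ∀ t : ℝ, 0 < t → t < 1 →
      (1 - t) * (c₀ * ‖w - x‖ ^ 2) ≤ bregReal Θ ξ w := by
    intro t ht ht'
    obtain ⟨h1, h2⟩ := h.tilt_convex ξ hw (h.argminTilt_mem ξ) ht ht'
    have h3 := h.argminTilt_le ξ h1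
    rw [← hx] at h2 h3
    have h4 : t * ((1 - t) * (c₀ * ‖w - x‖ ^ 2)) ≤ t * bregReal Θ ξ w := by
      rw [bregReal, inner_sub_right, ← hx]
      nlinarith
    exact le_of_mul_le_mul_left h4 ht
  have hlim : Tendsto (fun t : ℝ => (1 - t) * (c₀ * ‖w - x‖ ^ 2)) (𝓝[>] 0)
      (𝓝 ((1 - 0) * (c₀ * ‖w - x‖ ^ 2))) := by
    refine Tendsto.mono_left ?_ nhdsWithin_le_nhds
    exact Continuous.tendsto (by fun_prop) 0
  rw [sub_zero, one_mul] at hlim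
  refine le_of_tendsto hlim ?_
  filter_upwards [Ioo_mem_nhdsGT (show (0 : ℝ) < 1 by norm_num)] with t ht
  exact key t ht.1 ht.2

theorem bregReal_nonneg (h : IsPenalty c₀ Θ) (ξ : X) {w : X} (hw : w ∈ effDom Θ) :
    0 ≤ bregReal Θ ξ w :=
  le_trans (mul_nonneg h.pos.le (sq_nonneg _)) (h.norm_sq_le_bregReal ξ hw)

/-- The two mutual Bregman distances add up to an inner product. Bounding one of them below by `c₀`
times the squared distance and applying Young's inequality leaves `‖ξ' - ξ‖² / (4c₀)` for the other.
-/
theorem bregReal_argminTilt_le (h : IsPenalty c₀ Θ) (ξ ξ' : X) :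
    bregReal Θ ξ' (argminTilt Θ ξ) ≤ ‖ξ' - ξ‖ ^ 2 / (4 * c₀) := by
  have h1 := bregReal_add_symm (Θ := Θ) ξ ξ'
  have h2 := h.norm_sq_le_bregReal ξ (h.argminTilt_mem ξ')
  have h3 := real_inner_le_norm (ξ' - ξ) (argminTilt Θ ξ' - argminTilt Θ ξ)
  have hc := h.pos
  rw [le_div_iff₀ (by positivity)]
  nlinarith [sq_nonneg (2 * c₀ * ‖argminTilt Θ ξ' - argminTilt Θ ξ‖ - ‖ξ' - ξ‖)]

theorem bregReal_le (h : IsPenalty c₀ Θ) (ξ ξ' w : X) :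
    bregReal Θ ξ' w ≤ bregReal Θ ξ w + ‖ξ' - ξ‖ ^ 2 / (4 * c₀)
      - inner ℝ (ξ' - ξ) (w - argminTilt Θ ξ) := by
  linarith [bregReal_sub_eq (Θ := Θ) ξ ξ' w, h.bregReal_argminTilt_le ξ ξ']

/-- Here both mutual distances are bounded below, which gives the factor `2c₀`. The map from tilts
to minimizers is thus Lipschitz. -/
theorem norm_argminTilt_sub_le (h : IsPenalty c₀ Θ) (ξ ξ' : X) :
    ‖argminTilt Θ ξ' - argminTilt Θ ξ‖ ≤ ‖ξ' - ξ‖ / (2 * c₀) := by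
  have h1 := bregReal_add_symm (Θ := Θ) ξ ξ'
  have h2 := h.norm_sq_le_bregReal ξ (h.argminTilt_mem ξ')
  have h2' := h.norm_sq_le_bregReal ξ' (h.argminTilt_mem ξ)
  rw [norm_sub_rev] at h2'
  have h3 := real_inner_le_norm (ξ' - ξ) (argminTilt Θ ξ' - argminTilt Θ ξ)
  have hc := h.pos
  rw [le_div_iff₀ (by positivity)]
  rcases (norm_nonneg (argminTilt Θ ξ' - argminTilt Θ ξ)).eq_or_lt with h0 | h0
  · rw [← h0]; simp
  · refine le_of_mul_le_mul_right ?_ h0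
    nlinarith

theorem continuous_argminTilt (h : IsPenalty c₀ Θ) : Continuous (argminTilt Θ) := by
  refine continuous_iff_continuousAt.2 fun ξ => ?_
  refine tendsto_iff_norm_sub_tendsto_zero.2 ?_
  have hlim : Tendsto (fun ξ' : X => ‖ξ' - ξ‖ / (2 * c₀)) (𝓝 ξ) (𝓝 (‖ξ - ξ‖ / (2 * c₀))) :=
    Continuous.tendsto (by fun_prop) ξ
  rw [sub_self, norm_zero, zero_div] at hlim
  exact squeeze_zero (fun _ => norm_nonneg _) (fun ξ' => h.norm_argminTilt_sub_le ξ ξ') hlim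

/-- `Θ` itself need not be continuous. By the three-point identity the change in `ξ` is an inner
product plus a Bregman distance that is quadratically small in the change of `ξ`. -/
theorem continuous_bregReal (h : IsPenalty c₀ Θ) (w : X) :
    Continuous fun ξ => bregReal Θ ξ w := by
  have hc := h.continuous_argminTilt
  refine continuous_iff_continuousAt.2 fun ξ => ?_
  have heq : ∀ ξ' : X, bregReal Θ ξ' w = bregReal Θ ξ w + bregReal Θ ξ' (argminTilt Θ ξ)
      - inner ℝ (ξ' - ξ) (w - argminTilt Θ ξ) := fun ξ' => by
    linarith [bregReal_sub_eq (Θ := Θ) ξ ξ' w]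
  have hlim : Tendsto (fun ξ' : X => ‖ξ' - ξ‖ ^ 2 / (4 * c₀)) (𝓝 ξ)
      (𝓝 (‖ξ - ξ‖ ^ 2 / (4 * c₀))) := Continuous.tendsto (by fun_prop) ξ
  rw [sub_self, norm_zero, zero_pow two_ne_zero, zero_div] at hlim
  have h1 : Tendsto (fun ξ' : X => bregReal Θ ξ' (argminTilt Θ ξ)) (𝓝 ξ) (𝓝 0) :=
    squeeze_zero (fun ξ' => h.bregReal_nonneg ξ' (h.argminTilt_mem ξ))
      (fun ξ' => h.bregReal_argminTilt_le ξ ξ') hlim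
  have h2 : Tendsto (fun ξ' : X => (inner ℝ (ξ' - ξ) (w - argminTilt Θ ξ) : ℝ)) (𝓝 ξ)
      (𝓝 (inner ℝ (ξ - ξ) (w - argminTilt Θ ξ))) :=
    Continuous.tendsto (by fun_prop) ξ
  rw [sub_self, inner_zero_left] at h2
  have h3 := (tendsto_const_nhds (x := bregReal Θ ξ w)).add h1 |>.sub h2
  rw [add_zero, sub_zero] at h3
  exact h3.congr fun ξ' => (heq ξ').symm

end IsPenalty

end ConvexAnalysis

/-! ### The duality mapping of a uniformly smooth space. -/

section Duality

variable {Y : Type*} [NormedAddCommGroup Y] [NormedSpace ℝ Y]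

/-- A Hahn–Banach norming functional scaled by `‖y‖ ^ (p - 1)` shows that the choice is not vacuous.
Smoothness is not needed for this. -/
theorem dualityMap_spec {p : ℝ} (hp : 1 < p) (y : Y) :
    ‖dualityMap p y‖ = ‖y‖ ^ (p - 1) ∧ dualityMap p y y = ‖y‖ ^ p := by
  refine Classical.epsilon_spec
    (p := fun f : StrongDual ℝ Y => ‖f‖ = ‖y‖ ^ (p - 1) ∧ f y = ‖y‖ ^ p) ?_
  rcases eq_or_ne y 0 with rfl | hy
  · refine ⟨0, ?_, ?_⟩
    · rw [norm_zero, norm_zero, Real.zero_rpow (by linarith)]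
    · rw [norm_zero, Real.zero_rpow (by linarith)]; rfl
  · obtain ⟨g, hg, hgy⟩ := exists_dual_vector ℝ y (norm_ne_zero_iff.2 hy)
    have hpos : 0 < ‖y‖ := norm_pos_iff.2 hy
    refine ⟨(‖y‖ ^ (p - 1)) • g, ?_, ?_⟩
    · rw [norm_smul, hg, mul_one, Real.norm_of_nonneg (Real.rpow_nonneg hpos.le _)]
    · rw [smul_apply, hgy, smul_eq_mul]
      change ‖y‖ ^ (p - 1) * ‖y‖ = ‖y‖ ^ p
      rw [← Real.rpow_add_one hpos.ne', sub_add_cancel]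

/-- Adding `f (x - h) ≤ ‖x - h‖` and `f' (x' + h) ≤ ‖x + h‖ + ‖x' - x‖` bounds `(f' - f) h` by the
smoothness defect plus `‖x' - x‖`. Since `f` and `f'` are arbitrary norming functionals, any
selection of the duality mapping is covered. -/
theorem UniformlySmooth.norm_sub_le (h : UniformlySmooth Y) {ε : ℝ} (hε : 0 < ε) :
    ∃ t : ℝ, 0 < t ∧ ∀ x x' : Y, ∀ f f' : StrongDual ℝ Y, ‖x‖ = 1 → ‖f‖ ≤ 1 → ‖f'‖ ≤ 1 →
      f x = 1 → f' x' = 1 → ‖x' - x‖ ≤ t → ‖f' - f‖ ≤ ε := by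
  obtain ⟨t, ht, hsm⟩ := h (ε / 2) (by positivity)
  refine ⟨ε / 2 * t, by positivity, fun x x' f f' hx hf hf' hfx hfx' hxx' => ?_⟩
  have key : ∀ h : Y, ‖h‖ = t → (f' - f) h ≤ ε * t := by
    intro h hh
    have h1 := hsm x h hx hh.le
    have h2 : f (x - h) ≤ ‖x - h‖ :=
      (le_abs_self _).trans ((f.le_opNorm _).trans
        (mul_le_of_le_one_left (norm_nonneg _) hf))
    have h3 : f' (x' + h) ≤ ‖x' + h‖ :=
      (le_abs_self _).trans ((f'.le_opNorm _).trans
        (mul_le_of_le_one_left (norm_nonneg _) hf'))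
    have h4 : ‖x' + h‖ ≤ ‖x + h‖ + ‖x' - x‖ := by
      have : x' + h = (x + h) + (x' - x) := by abel
      rw [this]
      exact norm_add_le _ _
    rw [map_sub, hfx] at h2
    rw [map_add, hfx'] at h3
    rw [sub_apply]
    rw [hh] at h1
    linarith
  refine ContinuousLinearMap.opNorm_le_bound _ hε.le fun v => ?_
  rcases eq_or_ne v 0 with rfl | hv
  · simp
  have hv' : 0 < ‖v‖ := norm_pos_iff.2 hv
  have hs : ∀ s : ℝ, |s| = t / ‖v‖ → s * (f' - f) v ≤ ε * t := by
    intro s hs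
    have := key (s • v) (by
      rw [norm_smul, Real.norm_eq_abs, hs, div_mul_cancel₀ _ hv'.ne'])
    rwa [map_smul, smul_eq_mul] at this
  have hq : 0 < t / ‖v‖ := by positivity
  have h1 := hs (t / ‖v‖) (abs_of_pos hq)
  have h2 := hs (-(t / ‖v‖)) (by rw [abs_neg, abs_of_pos hq])
  have h3 : t / ‖v‖ * |(f' - f) v| ≤ t / ‖v‖ * (ε * ‖v‖) := by
    have e : t / ‖v‖ * (ε * ‖v‖) = ε * t := by field_simp
    rw [e]
    rcases abs_cases ((f' - f) v) with ⟨h4, _⟩ | ⟨h4, _⟩ <;> rw [h4]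
    · exact h1
    · linarith
  exact le_of_mul_le_mul_left h3 hq

/-- Dividing by `‖x‖ ^ (p - 1)` produces norming functionals of the unit vectors `x / ‖x‖`, to which
the previous estimate applies. -/
theorem UniformlySmooth.continuousAt_dualityMap (h : UniformlySmooth Y) {p : ℝ} (hp : 1 < p)
    {y : Y} (hy : y ≠ 0) : ContinuousAt (dualityMap p : Y → StrongDual ℝ Y) y := by
  set f : Y → StrongDual ℝ Y := fun x => (‖x‖ ^ (p - 1))⁻¹ • dualityMap p x with hf
  have hnorm : ∀ x : Y, x ≠ 0 → ‖f x‖ ≤ 1 := by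
    intro x hx
    have hpos : 0 < ‖x‖ ^ (p - 1) := Real.rpow_pos_of_pos (norm_pos_iff.2 hx) _
    rw [hf, norm_smul, (dualityMap_spec hp x).1, norm_inv, Real.norm_of_nonneg hpos.le,
      inv_mul_cancel₀ hpos.ne']
  have hval : ∀ x : Y, x ≠ 0 → f x (‖x‖⁻¹ • x) = 1 := by
    intro x hx
    have hx' := norm_pos_iff.2 hx
    have hpos : 0 < ‖x‖ ^ (p - 1) := Real.rpow_pos_of_pos hx' _
    rw [hf, smul_apply, map_smul, (dualityMap_spec hp x).2, smul_eq_mul,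
      smul_eq_mul, ← sub_add_cancel p 1, Real.rpow_add_one hx'.ne', sub_add_cancel]
    field_simp
  have hunit : ContinuousAt (fun x : Y => ‖x‖⁻¹ • x) y :=
    (continuousAt_id.norm.inv₀ (norm_ne_zero_iff.2 hy)).smul continuousAt_id
  have hne : ∀ᶠ x in 𝓝 y, x ≠ 0 := isOpen_ne.mem_nhds hy
  have hfc : ContinuousAt f y := by
    refine Metric.tendsto_nhds.2 fun ε hε => ?_
    obtain ⟨t, ht, hsm⟩ := h.norm_sub_le (half_pos hε)
    filter_upwards [hne, Metric.tendsto_nhds.1 hunit t ht] with x hx hxt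
    have := hsm (‖y‖⁻¹ • y) (‖x‖⁻¹ • x) (f y) (f x) (by
      rw [norm_smul, norm_inv, norm_norm, inv_mul_cancel₀ (norm_ne_zero_iff.2 hy)])
      (hnorm y hy) (hnorm x hx) (hval y hy) (hval x hx) (by rw [← dist_eq_norm]; exact hxt.le)
    rw [dist_eq_norm]
    linarith
  have hpow : ContinuousAt (fun x : Y => ‖x‖ ^ (p - 1)) y :=
    continuousAt_id.norm.rpow_const (Or.inl (norm_ne_zero_iff.2 hy))
  refine (hpow.smul hfc).congr ?_
  filter_upwards [hne] with x hx
  have hpos : 0 < ‖x‖ ^ (p - 1) := Real.rpow_pos_of_pos (norm_pos_iff.2 hx) _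
  change ‖x‖ ^ (p - 1) • ((‖x‖ ^ (p - 1))⁻¹ • dualityMap p x) = dualityMap p x
  rw [smul_smul, mul_inv_cancel₀ hpos.ne', one_smul]

end Duality

/-! ### Step size bounds and the effect of one inner step on the Bregman distance. -/

namespace TPGSetup

variable {X : Type*} [NormedAddCommGroup X] [InnerProductSpace ℝ X] [CompleteSpace X]
  {I : ℕ} {Y : Fin I → Type*} [∀ i, NormedAddCommGroup (Y i)] [∀ i, NormedSpace ℝ (Y i)]

/-- The hypotheses on the spaces, the functional, the operators and the constants. -/
structure Standing (S : TPGSetup X Y) (y : ∀ i, Y i) (c₀ ρ C η ν : ℝ) : Prop where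
  smooth : ∀ i, UniformlySmooth (Y i)
  two_lt_q : 2 < S.q
  one_lt_τ : 1 < S.τ
  μ₀_pos : 0 < S.μ₀
  μ₁_pos : 0 < S.μ₁
  penalty : IsPenalty c₀ S.Θ
  op : S.OperatorAssumption y c₀ ρ C η
  c₁_pos : 0 < S.c₁ c₀ η
  one_lt_ν : 1 < ν

/-- A lower bound for the step size in units of `‖r‖ ^ (2 - q / 2)`. -/
noncomputable def stepLower (S : TPGSetup X Y) (C : ℝ) : ℝ := min (S.μ₀ / (C ^ 2 + 1)) S.μ₁

/-- `w` solves the system, lies in the effective domain and in the ball of radius `3ρ`. -/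
structure IsLocalSolution (S : TPGSetup X Y) (y : ∀ i, Y i) (ρ : ℝ) (w : X) : Prop where
  mem_effDom : w ∈ effDom S.Θ
  eq : ∀ i, S.H i w = y i
  mem_ball : w ∈ Metric.ball S.σ₀ (3 * ρ)

namespace Standing

variable {S : TPGSetup X Y} {y : ∀ i, Y i} {c₀ ρ C η ν : ℝ}

theorem one_lt_half_q (h : S.Standing y c₀ ρ C η ν) : 1 < S.q / 2 := by
  have := h.two_lt_q
  linarith

theorem c₀_pos (h : S.Standing y c₀ ρ C η ν) : 0 < c₀ := h.penalty.pos

theorem σ₀_mem_ball (h : S.Standing y c₀ ρ C η ν) : S.σ₀ ∈ Metric.ball S.σ₀ (3 * ρ) := by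
  have := h.op.rho_pos
  exact Metric.mem_ball_self (by positivity)

theorem C_nonneg [NeZero I] (h : S.Standing y c₀ ρ C η ν) : 0 ≤ C :=
  (norm_nonneg _).trans (h.op.deriv_bound (Fin.ofNat I 0) _ h.σ₀_mem_ball)

theorem stepLower_pos (h : S.Standing y c₀ ρ C η ν) : 0 < S.stepLower C := by
  have := h.μ₀_pos
  exact lt_min (by positivity) h.μ₁_pos

theorem inner_adjDual (i : Fin I) (x : X) (r : Y i) (v : X) :
    (inner ℝ (S.adjDual i x r) v : ℝ) = dualityMap (S.q / 2) r (fderiv ℝ (S.H i) x v) := by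
  rw [adjDual, InnerProductSpace.toDual_symm_apply]
  rfl

theorem norm_adjDual_le (h : S.Standing y c₀ ρ C η ν) (i : Fin I) {x : X}
    (hx : x ∈ Metric.ball S.σ₀ (3 * ρ)) (r : Y i) :
    ‖S.adjDual i x r‖ ≤ C * ‖r‖ ^ (S.q / 2 - 1) := by
  rw [adjDual, LinearIsometryEquiv.norm_map, mul_comm,
    ← (dualityMap_spec h.one_lt_half_q r).1]
  refine (ContinuousLinearMap.opNorm_comp_le _ _).trans ?_
  gcongr
  exact h.op.deriv_bound i x hx

/-- Collects all that is used about the minimum in the step rule, with the convention for `g = 0`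
absorbed into `α`. The `C ^ 2 + 1` inside `stepLower` avoids dividing by zero when `C = 0`. -/
theorem exists_stepSize_eq (h : S.Standing y c₀ ρ C η ν) {δ : ℝ} {i : Fin I} {r : Y i}
    {g : X} (hr0 : 0 < ‖r‖) (hr : S.τ * δ < ‖r‖) :
    ∃ α : ℝ, S.stepSize δ r g = α * ‖r‖ ^ (2 - S.q / 2) ∧ 0 < α ∧ α ≤ S.μ₁ ∧
      α * ‖g‖ ^ 2 ≤ S.μ₀ * (‖r‖ ^ (S.q / 2 - 1)) ^ 2 ∧
      (‖g‖ ≤ C * ‖r‖ ^ (S.q / 2 - 1) → S.stepLower C ≤ α) := by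
  have hμ₀ := h.μ₀_pos
  have hμ₁ := h.μ₁_pos
  have hp : 0 < ‖r‖ ^ (S.q / 2 - 1) := Real.rpow_pos_of_pos hr0 _
  have hsq : ‖r‖ ^ (2 * (S.q / 2 - 1)) = (‖r‖ ^ (S.q / 2 - 1)) ^ 2 := by
    rw [← Real.rpow_mul_natCast hr0.le, mul_comm]
    norm_num
  by_cases hg : g = 0
  · refine ⟨S.μ₁, ?_, hμ₁, le_rfl, ?_, fun _ => min_le_right _ _⟩
    · rw [stepSize, if_pos hr, if_pos hg]
    · rw [hg, norm_zero, zero_pow two_ne_zero, mul_zero]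
      positivity
  · have hg' : 0 < ‖g‖ := norm_pos_iff.2 hg
    refine ⟨min (S.μ₀ * (‖r‖ ^ (S.q / 2 - 1)) ^ 2 / ‖g‖ ^ 2) S.μ₁, ?_,
      lt_min (by positivity) hμ₁, min_le_right _ _, ?_, fun hgC => ?_⟩
    · rw [stepSize, if_pos hr, if_neg hg, hsq]
    · rw [← le_div_iff₀ (by positivity)]
      exact min_le_left _ _
    · refine min_le_min_right _ ?_
      rw [div_le_div_iff₀ (by positivity) (by positivity), mul_assoc]
      gcongr
      calc ‖g‖ ^ 2 ≤ (C * ‖r‖ ^ (S.q / 2 - 1)) ^ 2 := by gcongr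
        _ ≤ (‖r‖ ^ (S.q / 2 - 1)) ^ 2 * (C ^ 2 + 1) := by
          rw [mul_pow]
          nlinarith [sq_nonneg (‖r‖ ^ (S.q / 2 - 1))]

theorem stepSize_of_le {δ : ℝ} {i : Fin I} {r : Y i} {g : X} (hr : ‖r‖ ≤ S.τ * δ) :
    S.stepSize δ r g = 0 := by
  rw [stepSize, if_neg (not_lt.2 hr)]

theorem norm_pos_of_lt (h : S.Standing y c₀ ρ C η ν) {δ : ℝ} (hδ : 0 ≤ δ) {i : Fin I} {r : Y i}
    (hr : S.τ * δ < ‖r‖) : 0 < ‖r‖ :=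
  lt_of_le_of_lt (mul_nonneg (zero_le_one.trans h.one_lt_τ.le) hδ) hr

theorem stepSize_nonneg (h : S.Standing y c₀ ρ C η ν) {δ : ℝ} (hδ : 0 ≤ δ) {i : Fin I} (r : Y i)
    (g : X) : 0 ≤ S.stepSize δ r g := by
  rcases le_or_gt ‖r‖ (S.τ * δ) with hr | hr
  · rw [stepSize_of_le hr]
  · obtain ⟨α, h1, h2, -⟩ := h.exists_stepSize_eq (g := g) (h.norm_pos_of_lt hδ hr) hr
    rw [h1]
    positivity

theorem stepSize_eq_zero_iff (h : S.Standing y c₀ ρ C η ν) {δ : ℝ} (hδ : 0 ≤ δ) {i : Fin I}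
    (r : Y i) (g : X) : S.stepSize δ r g = 0 ↔ ‖r‖ ≤ S.τ * δ := by
  refine ⟨fun h0 => ?_, stepSize_of_le⟩
  by_contra hr
  have hr := not_le.1 hr
  have hr0 := h.norm_pos_of_lt hδ hr
  obtain ⟨α, h1, h2, -⟩ := h.exists_stepSize_eq (g := g) hr0 hr
  rw [h1] at h0
  exact absurd h0 (by positivity)

theorem stepSize_mul_norm_sq_le (h : S.Standing y c₀ ρ C η ν) {δ : ℝ} (hδ : 0 ≤ δ) {i : Fin I}
    (r : Y i) (g : X) : S.stepSize δ r g * ‖g‖ ^ 2 ≤ S.μ₀ * ‖r‖ ^ (S.q / 2) := by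
  have hμ₀ := h.μ₀_pos
  rcases le_or_gt ‖r‖ (S.τ * δ) with hr | hr
  · rw [stepSize_of_le hr, zero_mul]
    positivity
  · have hr0 := h.norm_pos_of_lt hδ hr
    obtain ⟨α, h1, h2, h3, h4, -⟩ := h.exists_stepSize_eq (g := g) hr0 hr
    have e : ‖r‖ ^ (S.q / 2) = (‖r‖ ^ (S.q / 2 - 1)) ^ 2 * ‖r‖ ^ (2 - S.q / 2) := by
      rw [← Real.rpow_mul_natCast hr0.le, ← Real.rpow_add hr0]
      congr 1
      push_cast
      ring
    rw [h1, e, mul_right_comm, ← mul_assoc]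
    gcongr

theorem stepSize_mul_rpow_sub_one_le (h : S.Standing y c₀ ρ C η ν) {δ : ℝ} (hδ : 0 ≤ δ)
    {i : Fin I} (r : Y i) (g : X) :
    S.stepSize δ r g * ‖r‖ ^ (S.q / 2 - 1) ≤ S.μ₁ * ‖r‖ := by
  have hμ₁ := h.μ₁_pos
  rcases le_or_gt ‖r‖ (S.τ * δ) with hr | hr
  · rw [stepSize_of_le hr, zero_mul]
    positivity
  · have hr0 := h.norm_pos_of_lt hδ hr
    obtain ⟨α, h1, h2, h3, -⟩ := h.exists_stepSize_eq (g := g) hr0 hr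
    rw [h1, mul_assoc, ← Real.rpow_add hr0]
    have : 2 - S.q / 2 + (S.q / 2 - 1) = 1 := by ring
    rw [this, Real.rpow_one]
    gcongr

theorem rpow_half_q_eq (h : S.Standing y c₀ ρ C η ν) {i : Fin I} (r : Y i) :
    ‖r‖ ^ (S.q / 2) = ‖r‖ ^ (S.q / 2 - 1) * ‖r‖ := by
  have := h.one_lt_half_q
  rw [← Real.rpow_add_one' (norm_nonneg r) (by linarith), sub_add_cancel]

theorem stepSize_mul_rpow_le (h : S.Standing y c₀ ρ C η ν) {δ : ℝ} (hδ : 0 ≤ δ)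
    {i : Fin I} (r : Y i) (g : X) :
    S.stepSize δ r g * ‖r‖ ^ (S.q / 2) ≤ S.μ₁ * ‖r‖ ^ 2 := by
  rw [h.rpow_half_q_eq, ← mul_assoc, sq, ← mul_assoc]
  exact mul_le_mul_of_nonneg_right (h.stepSize_mul_rpow_sub_one_le hδ r g) (norm_nonneg r)

theorem stepLower_mul_sq_le (h : S.Standing y c₀ ρ C η ν) {δ : ℝ} (hδ : 0 ≤ δ)
    {i : Fin I} {r : Y i} {g : X} (hr : S.τ * δ < ‖r‖)
    (hg : ‖g‖ ≤ C * ‖r‖ ^ (S.q / 2 - 1)) :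
    S.stepLower C * ‖r‖ ^ 2 ≤ S.stepSize δ r g * ‖r‖ ^ (S.q / 2) := by
  have hr0 := h.norm_pos_of_lt hδ hr
  obtain ⟨α, h1, h2, h3, -, h4⟩ := h.exists_stepSize_eq (C := C) (g := g) hr0 hr
  rw [h1, mul_assoc, ← Real.rpow_add hr0, sub_add_cancel, Real.rpow_two]
  gcongr
  exact h4 hg

theorem stepSize_mul_norm_le [NeZero I] (h : S.Standing y c₀ ρ C η ν) {δ : ℝ} (hδ : 0 ≤ δ)
    {i : Fin I} {r : Y i} {g : X} (hg : ‖g‖ ≤ C * ‖r‖ ^ (S.q / 2 - 1)) :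
    S.stepSize δ r g * ‖g‖ ≤ C * S.μ₁ * ‖r‖ := by
  have h1 := h.stepSize_nonneg hδ r g
  have h2 := h.stepSize_mul_rpow_sub_one_le hδ r g
  have hC := h.C_nonneg
  calc S.stepSize δ r g * ‖g‖ ≤ S.stepSize δ r g * (C * ‖r‖ ^ (S.q / 2 - 1)) := by gcongr
    _ = C * (S.stepSize δ r g * ‖r‖ ^ (S.q / 2 - 1)) := by ring
    _ ≤ C * (S.μ₁ * ‖r‖) := by gcongr
    _ = C * S.μ₁ * ‖r‖ := by ring

/-- With `e` the linearization error, `H'(z)(w - z) = (y - d) - e - r`. Pairing with `J(r)`, the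
term `-r` yields `-‖r‖^(q/2)`. The noise costs `1/τ`, because `δ ≤ ‖r‖/τ`; the cone condition costs
`η(1 + 1/τ)`; the quadratic term costs `μ₀/(4c₀)`. What remains is exactly `c₁`. -/
theorem bregReal_gradient_step_le (h : S.Standing y c₀ ρ C η ν) {δ : ℝ} (hδ : 0 ≤ δ)
    {i : Fin I} {d : Y i} (hd : ‖y i - d‖ ≤ δ) {ζ w : X}
    (hz : argminTilt S.Θ ζ ∈ Metric.ball S.σ₀ (3 * ρ)) (hw : S.IsLocalSolution y ρ w)
    {r : Y i} (hr : r = S.H i (argminTilt S.Θ ζ) - d)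
    {g : X} (hg : g = S.adjDual i (argminTilt S.Θ ζ) r) :
    bregReal S.Θ (ζ - S.stepSize δ r g • g) w
      ≤ bregReal S.Θ ζ w - S.c₁ c₀ η * S.stepSize δ r g * ‖r‖ ^ (S.q / 2) := by
  set z := argminTilt S.Θ ζ with hzdef
  set μ := S.stepSize δ r g with hμ
  have hc₀ := h.c₀_pos
  have hμnn : 0 ≤ μ := h.stepSize_nonneg hδ r g
  have hτ : 0 < S.τ := zero_lt_one.trans h.one_lt_τ
  have hη := h.op.eta_pos
  rcases le_or_gt ‖r‖ (S.τ * δ) with hrl | hrl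
  · have : μ = 0 := stepSize_of_le hrl
    rw [this]
    simp
  have key := h.penalty.bregReal_le ζ (ζ - μ • g) w
  have e1 : ζ - μ • g - ζ = -(μ • g) := by abel
  rw [e1, norm_neg, norm_smul, Real.norm_of_nonneg hμnn, inner_neg_left, inner_smul_left,
    ← hzdef] at key
  simp only [conj_trivial] at key
  have hJ := dualityMap_spec h.one_lt_half_q r
  set J := dualityMap (S.q / 2) r with hJdef
  have hinner : (inner ℝ g (w - z) : ℝ) = J (fderiv ℝ (S.H i) z (w - z)) := by
    rw [hg, inner_adjDual]
  set e := S.H i w - S.H i z - fderiv ℝ (S.H i) z (w - z) with he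
  have hcone : ‖e‖ ≤ η * ‖S.H i w - S.H i z‖ := h.op.tangential_cone i w hw.mem_ball z hz
  have hdiff : S.H i w - S.H i z = (y i - d) - r := by
    rw [hw.eq i, hr]; abel
  have hA : fderiv ℝ (S.H i) z (w - z) = ((y i - d) - e) - r := by
    have : fderiv ℝ (S.H i) z (w - z) = (S.H i w - S.H i z) - e := by rw [he]; abel
    rw [this, hdiff]; abel
  have hδr : δ ≤ ‖r‖ / S.τ := by
    rw [le_div_iff₀ hτ, mul_comm]
    exact hrl.le
  have hn1 : ‖S.H i w - S.H i z‖ ≤ ‖r‖ / S.τ + ‖r‖ := by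
    rw [hdiff]
    exact (norm_sub_le _ _).trans (by linarith)
  have hn2 : ‖(y i - d) - e‖ ≤ (η + (1 + η) / S.τ) * ‖r‖ := by
    refine (norm_sub_le _ _).trans ?_
    have h1 : η * ‖S.H i w - S.H i z‖ ≤ η * (‖r‖ / S.τ + ‖r‖) := by gcongr
    have h2 : (η + (1 + η) / S.τ) * ‖r‖ = ‖r‖ / S.τ + η * (‖r‖ / S.τ + ‖r‖) := by
      field_simp
      ring
    rw [h2]
    linarith
  have hJle : J ((y i - d) - e) ≤ (η + (1 + η) / S.τ) * ‖r‖ ^ (S.q / 2) := by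
    calc J ((y i - d) - e) ≤ ‖J‖ * ‖(y i - d) - e‖ := (le_abs_self _).trans (J.le_opNorm _)
      _ ≤ ‖r‖ ^ (S.q / 2 - 1) * ((η + (1 + η) / S.τ) * ‖r‖) := by
        rw [hJ.1]
        gcongr
      _ = (η + (1 + η) / S.τ) * ‖r‖ ^ (S.q / 2) := by
        rw [h.rpow_half_q_eq r]
        ring
  have hin : (inner ℝ g (w - z) : ℝ)
      ≤ (η + (1 + η) / S.τ) * ‖r‖ ^ (S.q / 2) - ‖r‖ ^ (S.q / 2) := by
    rw [hinner, hA, map_sub, hJ.2]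
    linarith
  have hsq := h.stepSize_mul_norm_sq_le hδ r g
  rw [← hμ] at hsq
  have h5 : (μ * ‖g‖) ^ 2 / (4 * c₀) ≤ μ * (S.μ₀ / (4 * c₀)) * ‖r‖ ^ (S.q / 2) := by
    rw [div_le_iff₀ (by positivity)]
    have : μ * (S.μ₀ / (4 * c₀)) * ‖r‖ ^ (S.q / 2) * (4 * c₀)
        = μ * (S.μ₀ * ‖r‖ ^ (S.q / 2)) := by
      field_simp
    rw [this]
    nlinarith
  have h6 := mul_le_mul_of_nonneg_left hin hμnn
  rw [c₁]
  nlinarith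

/-- If the last step did not increase the distance, then `bregReal_le` read backwards bounds the
first-order term by `‖ξ - ξ'‖² / (4c₀)`. This accounts for `l` in `l² + l`; the quadratic term
accounts for `l²`. -/
theorem bregReal_momentum_step_le (h : S.Standing y c₀ ρ C η ν) {ξ ξ' w : X} {l : ℝ}
    (hl : 0 ≤ l) (hle : bregReal S.Θ ξ w ≤ bregReal S.Θ ξ' w) :
    bregReal S.Θ (ξ + l • (ξ - ξ')) w
      ≤ bregReal S.Θ ξ w + (l ^ 2 + l) / (4 * c₀) * ‖ξ - ξ'‖ ^ 2 := by
  have h1 := h.penalty.bregReal_le ξ (ξ + l • (ξ - ξ')) w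
  have h2 := h.penalty.bregReal_le ξ ξ' w
  have hc₀ := h.c₀_pos
  rw [add_sub_cancel_left, norm_smul, Real.norm_of_nonneg hl, inner_smul_left] at h1
  simp only [conj_trivial] at h1
  rw [← neg_sub ξ ξ', norm_neg, inner_neg_left] at h2
  have h3 : -(inner ℝ (ξ - ξ') (w - argminTilt S.Θ ξ) : ℝ) ≤ ‖ξ - ξ'‖ ^ 2 / (4 * c₀) := by
    linarith
  have h4 := mul_le_mul_of_nonneg_left h3 hl
  have e : (l ^ 2 + l) / (4 * c₀) * ‖ξ - ξ'‖ ^ 2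
      = (l * ‖ξ - ξ'‖) ^ 2 / (4 * c₀) + l * (‖ξ - ξ'‖ ^ 2 / (4 * c₀)) := by
    ring
  rw [e]
  linarith

end Standing

end TPGSetup

/-! ### Admissible runs: monotonicity, finite termination and stationarity. -/

namespace TPGSetup

variable {X : Type*} [NormedAddCommGroup X] [InnerProductSpace ℝ X] [CompleteSpace X]
  {I : ℕ} [NeZero I] {Y : Fin I → Type*} [∀ i, NormedAddCommGroup (Y i)]
  [∀ i, NormedSpace ℝ (Y i)]

section Indices

variable (S : TPGSetup X Y) (data : ∀ i, Y i) (δ : ℝ) (lam : ℕ → Fin I → ℝ)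

theorem exists_index (I : ℕ) [NeZero I] (m : ℕ) : ∃ n, ∃ i : Fin I, m = n * I + i :=
  ⟨m / I, ⟨m % I, Nat.mod_lt _ (NeZero.pos I)⟩, by
    rw [mul_comm]
    exact (Nat.div_add_mod m I).symm⟩

theorem iter_succ (n : ℕ) (i : Fin I) :
    S.iter data δ lam (n * I + i + 1)
      = S.step data δ i (lam n i) (S.iter data δ lam (n * I + i)) := by
  have h1 : (n * I + (i : ℕ)) / I = n := by
    rw [mul_comm, Nat.mul_add_div (NeZero.pos I), Nat.div_eq_of_lt i.isLt, add_zero]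
  have h2 : Fin.ofNat I (n * I + (i : ℕ)) = i := by
    ext
    rw [Fin.val_ofNat, mul_comm, Nat.mul_add_mod, Nat.mod_eq_of_lt i.isLt]
  rw [iter, h1, h2]

theorem xi_succ (n : ℕ) (i : Fin I) :
    S.xi data δ lam n (i + 1) = S.zeta data δ lam n i - S.mu data δ lam n i •
      S.adjDual i (S.z data δ lam n i) (S.residual data δ lam n i) := by
  have h : S.xi data δ lam n (i + 1) = (S.iter data δ lam (n * I + i + 1)).1 := rfl
  rw [h, iter_succ]
  rfl

theorem iter_succ_snd (n : ℕ) (i : Fin I) :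
    (S.iter data δ lam (n * I + i + 1)).2 = S.xi data δ lam n i := by
  rw [iter_succ]
  rfl

theorem xi_succ_zero (n : ℕ) : S.xi data δ lam (n + 1) 0 = S.xi data δ lam n I := by
  rw [xi, xi, add_mul, one_mul, add_zero]

theorem xi_zero_zero : S.xi data δ lam 0 0 = S.ξ₀ := by
  rw [xi, zero_mul, add_zero]
  rfl

theorem momentum_succ (n : ℕ) (i : Fin I) :
    S.momentum data δ lam n (i + 1) = S.xi data δ lam n (i + 1) - S.xi data δ lam n i := by
  have h : S.momentum data δ lam n (i + 1)
    = S.xi data δ lam n (i + 1) - (S.iter data δ lam (n * I + i + 1)).2 := rfl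
  rw [h, iter_succ_snd]

theorem momentum_succ_zero (n : ℕ) :
    S.momentum data δ lam (n + 1) 0 = S.momentum data δ lam n I := by
  rw [momentum, momentum, add_mul, one_mul, add_zero]

end Indices

/-- A run of the method whose data has noise level `δ ≥ 0` and whose combination parameters are
admissible. -/
structure IsAdmissibleRun (S : TPGSetup X Y) (y : ∀ i, Y i) (c₀ ρ η ν : ℝ) (data : ∀ i, Y i)
    (δ : ℝ) (lam : ℕ → Fin I → ℝ) : Prop where
  δ_nonneg : 0 ≤ δ
  noise : ∀ i, ‖y i - data i‖ ≤ δ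
  params : S.AdmissibleParams data δ lam c₀ ρ (S.c₁ c₀ η) ν

namespace IsAdmissibleRun

variable {S : TPGSetup X Y} {y : ∀ i, Y i} {c₀ ρ C η ν : ℝ} {data : ∀ i, Y i}
    {δ : ℝ} {lam : ℕ → Fin I → ℝ}

theorem bregReal_zeta_le (R : S.IsAdmissibleRun y c₀ ρ η ν data δ lam)
    (h : S.Standing y c₀ ρ C η ν) {w : X} {n : ℕ} {i : Fin I}
    (hle : bregReal S.Θ (S.iter data δ lam (n * I + i)).1 w
      ≤ bregReal S.Θ (S.iter data δ lam (n * I + i)).2 w) :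
    bregReal S.Θ (S.zeta data δ lam n i) w ≤ bregReal S.Θ (S.xi data δ lam n i) w
      + (lam n i ^ 2 + lam n i) / (4 * c₀) * ‖S.momentum data δ lam n i‖ ^ 2 :=
  h.bregReal_momentum_step_le (R.params.nonneg n i) hle

/-- The second admissibility condition pays for the extrapolation with the share `c₁/ν` of the
gradient decrease, leaving `(1 - 1/ν) c₁`. -/
theorem bregReal_xi_succ_add_le (R : S.IsAdmissibleRun y c₀ ρ η ν data δ lam)
    (h : S.Standing y c₀ ρ C η ν) {w : X} (hw : S.IsLocalSolution y ρ w) {n : ℕ} {i : Fin I}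
    (hle : bregReal S.Θ (S.iter data δ lam (n * I + i)).1 w
      ≤ bregReal S.Θ (S.iter data δ lam (n * I + i)).2 w)
    (hz : S.z data δ lam n i ∈ Metric.ball S.σ₀ (3 * ρ)) :
    bregReal S.Θ (S.xi data δ lam n (i + 1)) w
        + (1 - 1 / ν) * S.c₁ c₀ η * (S.mu data δ lam n i *
          ‖S.residual data δ lam n i‖ ^ (S.q / 2))
      ≤ bregReal S.Θ (S.xi data δ lam n i) w := by
  have h1 := R.bregReal_zeta_le h hle
  have h2 := h.bregReal_gradient_step_le R.δ_nonneg (R.noise i) hz hw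
    (r := S.residual data δ lam n i) rfl rfl
  have h3 := R.params.le_residual n i
  rw [xi_succ]
  have e : (1 - 1 / ν) * S.c₁ c₀ η * (S.mu data δ lam n i *
          ‖S.residual data δ lam n i‖ ^ (S.q / 2))
      = S.c₁ c₀ η * S.mu data δ lam n i * ‖S.residual data δ lam n i‖ ^ (S.q / 2)
        - S.c₁ c₀ η / ν * S.mu data δ lam n i * ‖S.residual data δ lam n i‖ ^ (S.q / 2) := by
    ring
  rw [e]
  change bregReal S.Θ (S.zeta data δ lam n i - S.mu data δ lam n i • _) w
    ≤ bregReal S.Θ (S.zeta data δ lam n i) w - S.c₁ c₀ η * S.mu data δ lam n i * _ at h2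
  change bregReal S.Θ (S.zeta data δ lam n i - S.mu data δ lam n i • S.adjDual i
    (argminTilt S.Θ (S.zeta data δ lam n i)) _) w + _ ≤ _
  linarith

theorem mu_nonneg (R : S.IsAdmissibleRun y c₀ ρ η ν data δ lam)
    (h : S.Standing y c₀ ρ C η ν) (n : ℕ) (i : Fin I) : 0 ≤ S.mu data δ lam n i :=
  h.stepSize_nonneg R.δ_nonneg _ _

theorem decrease_nonneg (R : S.IsAdmissibleRun y c₀ ρ η ν data δ lam)
    (h : S.Standing y c₀ ρ C η ν) (n : ℕ) (i : Fin I) :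
    0 ≤ (1 - 1 / ν) * S.c₁ c₀ η * (S.mu data δ lam n i *
      ‖S.residual data δ lam n i‖ ^ (S.q / 2)) := by
  have h1 := R.mu_nonneg h n i
  have h2 : 0 ≤ 1 - 1 / ν := by
    rw [sub_nonneg, div_le_one (zero_lt_one.trans h.one_lt_ν)]
    exact h.one_lt_ν.le
  have h3 := h.c₁_pos
  positivity

end IsAdmissibleRun

/-- The solution whose existence is assumed. -/
theorem Standing.exists_solution {S : TPGSetup X Y} {y : ∀ i, Y i} {c₀ ρ C η ν : ℝ}
    (h : S.Standing y c₀ ρ C η ν) :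
    ∃ w, S.IsLocalSolution y ρ w ∧ bregReal S.Θ S.ξ₀ w ≤ c₀ * ρ ^ 2 ∧ ‖w - S.σ₀‖ ≤ ρ := by
  obtain ⟨w, hw, heq, hD⟩ := h.op.exists_solution
  have hD' : bregReal S.Θ S.ξ₀ w ≤ c₀ * ρ ^ 2 := by
    rw [σ₀, h.penalty.bregmanDist_eq _ hw] at hD
    exact EReal.coe_le_coe_iff.1 hD
  have hρ := h.op.rho_pos
  have hn : ‖w - S.σ₀‖ ≤ ρ := by
    have h1 := (h.penalty.norm_sq_le_bregReal S.ξ₀ hw).trans hD'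
    exact le_of_sq_le_sq (le_of_mul_le_mul_left h1 h.c₀_pos) hρ.le
  refine ⟨w, ⟨hw, heq, ?_⟩, hD', hn⟩
  rw [Metric.mem_ball, dist_eq_norm]
  linarith

namespace IsAdmissibleRun

variable {S : TPGSetup X Y} {y : ∀ i, Y i} {c₀ ρ C η ν : ℝ} {data : ∀ i, Y i}
    {δ : ℝ} {lam : ℕ → Fin I → ℝ}

/-- The distance at `ζ` is at most `2c₀ρ²`, so `‖w - z‖ ≤ √2 ρ ≤ 3ρ/2`. The closed bound `5ρ/2`,
strictly below `3ρ`, survives the passage to the limit in the noise level. -/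
theorem z_dist_le_of_bregReal_le (R : S.IsAdmissibleRun y c₀ ρ η ν data δ lam)
    (h : S.Standing y c₀ ρ C η ν) {w : X} (hw : w ∈ effDom S.Θ) (hwρ : ‖w - S.σ₀‖ ≤ ρ)
    {n : ℕ} {i : Fin I}
    (hle : bregReal S.Θ (S.iter data δ lam (n * I + i)).1 w
      ≤ bregReal S.Θ (S.iter data δ lam (n * I + i)).2 w)
    (hle' : bregReal S.Θ (S.iter data δ lam (n * I + i)).1 w ≤ c₀ * ρ ^ 2) :
    ‖S.z data δ lam n i - S.σ₀‖ ≤ 5 / 2 * ρ := by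
  have h1 := R.bregReal_zeta_le h hle
  have h2 := R.params.le_radius n i
  have h3 := h.penalty.norm_sq_le_bregReal (S.zeta data δ lam n i) hw
  have hρ := h.op.rho_pos
  have h4 : c₀ * ‖w - S.z data δ lam n i‖ ^ 2 ≤ c₀ * (2 * ρ ^ 2) := by
    have : bregReal S.Θ (S.xi data δ lam n i) w ≤ c₀ * ρ ^ 2 := hle'
    change c₀ * ‖w - S.z data δ lam n i‖ ^ 2 ≤ _ at h3
    linarith
  have h5 : ‖w - S.z data δ lam n i‖ ≤ 3 / 2 * ρ := by
    refine le_of_sq_le_sq ?_ (by positivity)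
    have := le_of_mul_le_mul_left h4 h.c₀_pos
    nlinarith [sq_nonneg ρ]
  have h6 := norm_sub_le_norm_sub_add_norm_sub (S.z data δ lam n i) w S.σ₀
  rw [norm_sub_rev _ w] at h6
  linarith

/-- Monotonicity and the bound `c₀ρ²` must be proved together: the bound keeps `z` in the ball, and
only there does the next decrease hold. -/
theorem bregReal_iter_le_aux (R : S.IsAdmissibleRun y c₀ ρ η ν data δ lam)
    (h : S.Standing y c₀ ρ C η ν) {w : X} (hw : S.IsLocalSolution y ρ w)
    (hD : bregReal S.Θ S.ξ₀ w ≤ c₀ * ρ ^ 2) (hwρ : ‖w - S.σ₀‖ ≤ ρ) (m : ℕ) :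
    bregReal S.Θ (S.iter data δ lam m).1 w ≤ bregReal S.Θ (S.iter data δ lam m).2 w ∧
      bregReal S.Θ (S.iter data δ lam m).1 w ≤ c₀ * ρ ^ 2 := by
  induction m with
  | zero => exact ⟨le_rfl, hD⟩
  | succ m ih =>
    obtain ⟨n, i, rfl⟩ := exists_index I m
    have hz := R.z_dist_le_of_bregReal_le h hw.mem_effDom hwρ ih.1 ih.2
    have hρ := h.op.rho_pos
    have hz' : S.z data δ lam n i ∈ Metric.ball S.σ₀ (3 * ρ) := by
      rw [Metric.mem_ball, dist_eq_norm]
      linarith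
    have key := R.bregReal_xi_succ_add_le h hw ih.1 hz'
    have hnn := R.decrease_nonneg h n i
    have h2 : bregReal S.Θ (S.iter data δ lam (n * I + i + 1)).1 w
        ≤ bregReal S.Θ (S.iter data δ lam (n * I + i)).1 w := by
      change bregReal S.Θ (S.iter data δ lam (n * I + i + 1)).1 w + _
        ≤ bregReal S.Θ (S.iter data δ lam (n * I + i)).1 w at key
      linarith
    refine ⟨?_, h2.trans ih.2⟩
    rw [iter_succ_snd]
    exact h2

theorem norm_z_sub_le (R : S.IsAdmissibleRun y c₀ ρ η ν data δ lam)
    (h : S.Standing y c₀ ρ C η ν) (n : ℕ) (i : Fin I) :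
    ‖S.z data δ lam n i - S.σ₀‖ ≤ 5 / 2 * ρ := by
  obtain ⟨w, hw, hD, hwρ⟩ := h.exists_solution
  have := R.bregReal_iter_le_aux h hw hD hwρ (n * I + i)
  exact R.z_dist_le_of_bregReal_le h hw.mem_effDom hwρ this.1 this.2

theorem z_mem_ball (R : S.IsAdmissibleRun y c₀ ρ η ν data δ lam)
    (h : S.Standing y c₀ ρ C η ν) (n : ℕ) (i : Fin I) :
    S.z data δ lam n i ∈ Metric.ball S.σ₀ (3 * ρ) := by
  have := R.norm_z_sub_le h n i
  have hρ := h.op.rho_pos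
  rw [Metric.mem_ball, dist_eq_norm]
  linarith

/-- Once the assumed solution has confined all `z` to the ball, the induction runs for every
solution in the ball, without a bound on its initial distance. This is needed later for the limit of
the exact run. -/
theorem bregReal_iter_le (R : S.IsAdmissibleRun y c₀ ρ η ν data δ lam)
    (h : S.Standing y c₀ ρ C η ν) {w : X} (hw : S.IsLocalSolution y ρ w) (m : ℕ) :
    bregReal S.Θ (S.iter data δ lam m).1 w ≤ bregReal S.Θ (S.iter data δ lam m).2 w := by
  induction m with
  | zero => exact le_rfl
  | succ m ih =>
    obtain ⟨n, i, rfl⟩ := exists_index I m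
    have key := R.bregReal_xi_succ_add_le h hw ih (R.z_mem_ball h n i)
    have hnn := R.decrease_nonneg h n i
    rw [iter_succ_snd]
    change bregReal S.Θ (S.iter data δ lam (n * I + i + 1)).1 w + _ ≤ _ at key
    linarith

/-- Each inner step decreases the Bregman distance to every solution in the ball. -/
theorem bregReal_decrease (R : S.IsAdmissibleRun y c₀ ρ η ν data δ lam)
    (h : S.Standing y c₀ ρ C η ν) {w : X} (hw : S.IsLocalSolution y ρ w) (n : ℕ) (i : Fin I) :
    bregReal S.Θ (S.xi data δ lam n (i + 1)) w
        + (1 - 1 / ν) * S.c₁ c₀ η * (S.mu data δ lam n i *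
          ‖S.residual data δ lam n i‖ ^ (S.q / 2))
      ≤ bregReal S.Θ (S.xi data δ lam n i) w :=
  R.bregReal_xi_succ_add_le h hw (R.bregReal_iter_le h hw _) (R.z_mem_ball h n i)

/-- The decrease of the Bregman distance over one outer step. -/
theorem bregReal_outer_decrease (R : S.IsAdmissibleRun y c₀ ρ η ν data δ lam)
    (h : S.Standing y c₀ ρ C η ν) {w : X} (hw : S.IsLocalSolution y ρ w) (n : ℕ) :
    bregReal S.Θ (S.xi data δ lam (n + 1) 0) w
        + (1 - 1 / ν) * S.c₁ c₀ η * ∑ i, S.mu data δ lam n i *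
          ‖S.residual data δ lam n i‖ ^ (S.q / 2)
      ≤ bregReal S.Θ (S.xi data δ lam n 0) w := by
  have h1 : ∑ i : Fin I, (bregReal S.Θ (S.xi data δ lam n (i + 1)) w
      - bregReal S.Θ (S.xi data δ lam n i) w)
      = bregReal S.Θ (S.xi data δ lam n I) w - bregReal S.Θ (S.xi data δ lam n 0) w := by
    rw [← Finset.sum_range_sub (fun j => bregReal S.Θ (S.xi data δ lam n j) w) I,
      Finset.sum_range]
  have h2 : ∑ i : Fin I, (1 - 1 / ν) * S.c₁ c₀ η * (S.mu data δ lam n i *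
          ‖S.residual data δ lam n i‖ ^ (S.q / 2))
      ≤ ∑ i : Fin I, -(bregReal S.Θ (S.xi data δ lam n (i + 1)) w
      - bregReal S.Θ (S.xi data δ lam n i) w) := by
    refine Finset.sum_le_sum fun i _ => ?_
    linarith [R.bregReal_decrease h hw n i]
  rw [Finset.sum_neg_distrib, h1, ← Finset.mul_sum] at h2
  rw [xi_succ_zero]
  linarith

theorem antitone_bregReal (R : S.IsAdmissibleRun y c₀ ρ η ν data δ lam)
    (h : S.Standing y c₀ ρ C η ν) {w : X} (hw : S.IsLocalSolution y ρ w) :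
    Antitone fun n => bregReal S.Θ (S.xi data δ lam n 0) w := by
  refine antitone_nat_of_succ_le fun n => ?_
  have h1 := R.bregReal_outer_decrease h hw n
  rw [Finset.mul_sum] at h1
  have h2 := Finset.sum_nonneg fun i (_ : i ∈ Finset.univ) => R.decrease_nonneg h n i
  linarith

/-- The series of the terms by which the Bregman distance decreases converges. -/
theorem summable_mu_mul_residual (R : S.IsAdmissibleRun y c₀ ρ η ν data δ lam)
    (h : S.Standing y c₀ ρ C η ν) :
    Summable fun n => ∑ i, S.mu data δ lam n i *
      ‖S.residual data δ lam n i‖ ^ (S.q / 2) := by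
  obtain ⟨w, hw, -⟩ := h.exists_solution
  have hκ : 0 < (1 - 1 / ν) * S.c₁ c₀ η := by
    refine mul_pos ?_ h.c₁_pos
    rw [sub_pos, div_lt_one (zero_lt_one.trans h.one_lt_ν)]
    exact h.one_lt_ν
  refine summable_of_sum_range_le (c := bregReal S.Θ (S.xi data δ lam 0 0) w
    / ((1 - 1 / ν) * S.c₁ c₀ η)) (fun n => Finset.sum_nonneg fun i _ =>
      mul_nonneg (R.mu_nonneg h n i) (Real.rpow_nonneg (norm_nonneg _) _)) fun N => ?_
  rw [le_div_iff₀ hκ, mul_comm]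
  have key : bregReal S.Θ (S.xi data δ lam N 0) w + (1 - 1 / ν) * S.c₁ c₀ η *
      ∑ n ∈ Finset.range N, ∑ i, S.mu data δ lam n i *
        ‖S.residual data δ lam n i‖ ^ (S.q / 2) ≤ bregReal S.Θ (S.xi data δ lam 0 0) w := by
    induction N with
    | zero => simp
    | succ N ih =>
      rw [Finset.sum_range_succ, mul_add]
      linarith [R.bregReal_outer_decrease h hw N]
  linarith [h.penalty.bregReal_nonneg (S.xi data δ lam N 0) hw.mem_effDom]

theorem mu_eq_zero_iff (R : S.IsAdmissibleRun y c₀ ρ η ν data δ lam)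
    (h : S.Standing y c₀ ρ C η ν) (n : ℕ) (i : Fin I) :
    S.mu data δ lam n i = 0 ↔ ‖S.residual data δ lam n i‖ ≤ S.τ * δ :=
  h.stepSize_eq_zero_iff R.δ_nonneg _ _

theorem stepLower_mul_sq_le (R : S.IsAdmissibleRun y c₀ ρ η ν data δ lam)
    (h : S.Standing y c₀ ρ C η ν) {n : ℕ} {i : Fin I} (hi : S.mu data δ lam n i ≠ 0) :
    S.stepLower C * ‖S.residual data δ lam n i‖ ^ 2
      ≤ S.mu data δ lam n i * ‖S.residual data δ lam n i‖ ^ (S.q / 2) := by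
  rw [Ne, R.mu_eq_zero_iff h, not_le] at hi
  exact h.stepLower_mul_sq_le R.δ_nonneg hi (h.norm_adjDual_le i (R.z_mem_ball h n i) _)

/-- The iteration stops after finitely many steps when there is noise. -/
theorem stopSet_nonempty (R : S.IsAdmissibleRun y c₀ ρ η ν data δ lam)
    (h : S.Standing y c₀ ρ C η ν) (hδ : 0 < δ) : (S.stopSet data δ lam).Nonempty := by
  have hτ : 0 < S.τ := zero_lt_one.trans h.one_lt_τ
  have hκ := h.stepLower_pos
  have hlim := (R.summable_mu_mul_residual h).tendsto_atTop_zero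
  have hε : 0 < S.stepLower C * (S.τ * δ) ^ 2 := by positivity
  -- At this `n` the total decrease is smaller than what a single equation with residual above `τδ`
  -- would contribute.
  obtain ⟨n, hn⟩ := (hlim.eventually_lt_const hε).exists
  refine ⟨n, fun i => ?_⟩
  by_contra hi
  have h1 := R.stepLower_mul_sq_le h hi
  have h2 := Finset.single_le_sum (f := fun i => S.mu data δ lam n i *
      ‖S.residual data δ lam n i‖ ^ (S.q / 2)) (fun i _ =>
      mul_nonneg (R.mu_nonneg h n i) (Real.rpow_nonneg (norm_nonneg _) _)) (Finset.mem_univ i)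
  rw [R.mu_eq_zero_iff h, not_le] at hi
  have h3 : S.stepLower C * (S.τ * δ) ^ 2
      ≤ S.stepLower C * ‖S.residual data δ lam n i‖ ^ 2 := by
    gcongr
  linarith

/-- With zero step size the second admissibility condition has no budget left, so the extrapolation
itself must vanish. -/
theorem lam_smul_momentum_eq_zero (R : S.IsAdmissibleRun y c₀ ρ η ν data δ lam)
    (h : S.Standing y c₀ ρ C η ν) {n : ℕ} {i : Fin I} (hi : S.mu data δ lam n i = 0) :
    lam n i • S.momentum data δ lam n i = 0 := by
  have h1 := R.params.le_residual n i
  have h2 := R.params.nonneg n i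
  have hc := h.c₀_pos
  rw [hi, mul_zero, zero_mul, sub_zero] at h1
  rw [← norm_eq_zero, norm_smul, Real.norm_of_nonneg h2]
  rw [div_mul_eq_mul_div, div_le_iff₀ (by positivity), zero_mul] at h1
  have h3 : (lam n i * ‖S.momentum data δ lam n i‖) ^ 2 ≤ 0 := by
    have : 0 ≤ lam n i * ‖S.momentum data δ lam n i‖ ^ 2 := by positivity
    nlinarith
  exact pow_eq_zero_iff two_ne_zero |>.1 (le_antisymm h3 (sq_nonneg _))

/-- Once the stopping criterion holds, the run is stationary. -/
theorem stationary_step (R : S.IsAdmissibleRun y c₀ ρ η ν data δ lam)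
    (h : S.Standing y c₀ ρ C η ν) {n : ℕ} (hn : n ∈ S.stopSet data δ lam) :
    n + 1 ∈ S.stopSet data δ lam ∧ S.xi data δ lam (n + 1) 0 = S.xi data δ lam n 0 := by
  have hζ : ∀ i : Fin I, S.zeta data δ lam n i = S.xi data δ lam n i := fun i => by
    rw [zeta, R.lam_smul_momentum_eq_zero h (hn i), add_zero]
  have hstep : ∀ i : Fin I, S.xi data δ lam n (i + 1) = S.xi data δ lam n i := fun i => by
    rw [xi_succ, hn i, zero_smul, sub_zero, hζ]
  have hxi : ∀ j, j ≤ I → S.xi data δ lam n j = S.xi data δ lam n 0 := by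
    intro j
    induction j with
    | zero => exact fun _ => rfl
    | succ j ih => exact fun hj => (hstep ⟨j, hj⟩).trans (ih (Nat.le_of_succ_le hj))
  have hnext : S.xi data δ lam (n + 1) 0 = S.xi data δ lam n 0 := by
    rw [xi_succ_zero, hxi I le_rfl]
  have hζ' : ∀ i : Fin I, S.xi data δ lam (n + 1) i = S.xi data δ lam n 0 →
      S.momentum data δ lam (n + 1) i = 0 → S.mu data δ lam (n + 1) i = 0 ∧
        S.zeta data δ lam (n + 1) i = S.xi data δ lam n 0 := by
    intro i hx hm
    have e1 : S.zeta data δ lam (n + 1) i = S.xi data δ lam n 0 := by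
      rw [zeta, hx, hm, smul_zero, add_zero]
    have e2 : S.zeta data δ lam (n + 1) i = S.zeta data δ lam n i := by
      rw [e1, hζ, hxi i i.isLt.le]
    refine ⟨?_, e1⟩
    have := hn i
    rw [mu, residual, z] at this ⊢
    rwa [e2]
  -- The index `0` is excluded because the momentum carried into stage `n` may be nonzero; only its
  -- product with the combination parameter is known to vanish.
  have hlast : ∀ j, j ≤ I → j ≠ 0 → S.momentum data δ lam n j = 0 := by
    rintro (_ | k) hk hk0
    · exact absurd rfl hk0
    · refine (momentum_succ S data δ lam n ⟨k, hk⟩).trans ?_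
      change S.xi data δ lam n (k + 1) - S.xi data δ lam n k = 0
      rw [hxi _ hk, hxi k (Nat.le_of_succ_le hk), sub_self]
  have hall : ∀ j, j < I → S.xi data δ lam (n + 1) j = S.xi data δ lam n 0 ∧
      S.momentum data δ lam (n + 1) j = 0 := by
    intro j
    induction j with
    | zero =>
      refine fun _ => ⟨hnext, ?_⟩
      rw [momentum_succ_zero]
      exact hlast I le_rfl (NeZero.ne I)
    | succ j ih =>
      intro hj
      have hj' : j < I := Nat.lt_of_succ_lt hj
      obtain ⟨h1, h2⟩ := ih hj'
      obtain ⟨h3, h4⟩ := hζ' ⟨j, hj'⟩ h1 h2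
      have h5 : S.xi data δ lam (n + 1) (j + 1) = S.xi data δ lam n 0 := by
        have := xi_succ S data δ lam (n + 1) ⟨j, hj'⟩
        rw [h3, zero_smul, sub_zero, h4] at this
        exact this
      refine ⟨h5, (momentum_succ S data δ lam (n + 1) ⟨j, hj'⟩).trans ?_⟩
      change S.xi data δ lam (n + 1) (j + 1) - S.xi data δ lam (n + 1) j = 0
      rw [h5, h1, sub_self]
  exact ⟨fun i => (hζ' i (hall i i.isLt).1 (hall i i.isLt).2).1, hnext⟩

theorem stationary (R : S.IsAdmissibleRun y c₀ ρ η ν data δ lam)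
    (h : S.Standing y c₀ ρ C η ν) {n m : ℕ} (hn : n ∈ S.stopSet data δ lam) (hm : n ≤ m) :
    m ∈ S.stopSet data δ lam ∧ S.xi data δ lam m 0 = S.xi data δ lam n 0 := by
  induction m, hm using Nat.le_induction with
  | base => exact ⟨hn, rfl⟩
  | succ k _ ih =>
    have := R.stationary_step h ih.1
    exact ⟨this.1, this.2.trans ih.2⟩

/-- At the stopping index the Bregman distance to a solution is the least along the run. -/
theorem bregReal_stop_le (R : S.IsAdmissibleRun y c₀ ρ η ν data δ lam)
    (h : S.Standing y c₀ ρ C η ν) {w : X} (hw : S.IsLocalSolution y ρ w) {N : ℕ}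
    (hN : N ∈ S.stopSet data δ lam) (n : ℕ) :
    bregReal S.Θ (S.xi data δ lam N 0) w ≤ bregReal S.Θ (S.xi data δ lam n 0) w := by
  -- Stationarity lets `N` be replaced by `max N n`, so indices `n` beyond the stopping index need
  -- no separate treatment.
  rw [← (R.stationary h hN (le_max_left N n)).2]
  exact R.antitone_bregReal h hw (le_max_right N n)

end IsAdmissibleRun

end TPGSetup

/-! ### Stability: convergence of noisy iterates at a fixed index as the noise vanishes. -/

namespace TPGSetup

variable {X : Type*} [NormedAddCommGroup X] [InnerProductSpace ℝ X] [CompleteSpace X]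
  {I : ℕ} [NeZero I] {Y : Fin I → Type*} [∀ i, NormedAddCommGroup (Y i)]
  [∀ i, NormedSpace ℝ (Y i)]

namespace Standing

variable {S : TPGSetup X Y} {y : ∀ i, Y i} {c₀ ρ C η ν : ℝ}

theorem tendsto_adjDual (h : S.Standing y c₀ ρ C η ν) {ι : Type*} {l : Filter ι} {i : Fin I}
    {x : ι → X} {x₀ : X} {r : ι → Y i} {r₀ : Y i} (hx : Tendsto x l (𝓝 x₀))
    (hx₀ : x₀ ∈ Metric.ball S.σ₀ (3 * ρ)) (hr : Tendsto r l (𝓝 r₀)) (hr₀ : r₀ ≠ 0) :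
    Tendsto (fun k => S.adjDual i (x k) (r k)) l (𝓝 (S.adjDual i x₀ r₀)) := by
  have hJ : Tendsto (fun k => dualityMap (S.q / 2) (r k)) l (𝓝 (dualityMap (S.q / 2) r₀)) :=
    ((h.smooth i).continuousAt_dualityMap h.one_lt_half_q hr₀).tendsto.comp hr
  have hF : Tendsto (fun k => fderiv ℝ (S.H i) (x k)) l (𝓝 (fderiv ℝ (S.H i) x₀)) :=
    ((h.op.continuous_deriv i).continuousAt (Metric.isOpen_ball.mem_nhds hx₀)).tendsto.comp hx
  exact ((InnerProductSpace.toDual ℝ X).symm.continuous.tendsto _).comp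
    (((continuous_fst.clm_comp continuous_snd).tendsto
      (dualityMap (S.q / 2) r₀, fderiv ℝ (S.H i) x₀)).comp (hJ.prodMk_nhds hF))

/-- A nonzero limit residual eventually exceeds `τδ`. If the limit gradient vanishes, the quotient
becomes large and the minimum is eventually `μ₁`, in agreement with the convention for `g = 0`. -/
theorem tendsto_stepSize (h : S.Standing y c₀ ρ C η ν) {i : Fin I}
    {r : ℝ → Y i} {r₀ : Y i} {g : ℝ → X} {g₀ : X} (hr : Tendsto r (𝓝[>] (0 : ℝ)) (𝓝 r₀))
    (hr₀ : r₀ ≠ 0) (hg : Tendsto g (𝓝[>] (0 : ℝ)) (𝓝 g₀)) :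
    Tendsto (fun δ => S.stepSize δ (r δ) (g δ)) (𝓝[>] (0 : ℝ)) (𝓝 (S.stepSize 0 r₀ g₀)) := by
  have hr0 : 0 < ‖r₀‖ := norm_pos_iff.2 hr₀
  have hμ₀ := h.μ₀_pos
  have hδ : Tendsto (fun δ : ℝ => S.τ * δ) (𝓝[>] (0 : ℝ)) (𝓝 (S.τ * 0)) :=
    Tendsto.mono_left (Continuous.tendsto (by fun_prop) 0) nhdsWithin_le_nhds
  have hev : ∀ᶠ δ in 𝓝[>] (0 : ℝ), S.τ * δ < ‖r δ‖ :=
    hδ.eventually_lt hr.norm (by rwa [mul_zero])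
  have hpow : ∀ a : ℝ, Tendsto (fun δ => ‖r δ‖ ^ a) (𝓝[>] (0 : ℝ)) (𝓝 (‖r₀‖ ^ a)) :=
    fun a => hr.norm.rpow_const (Or.inl hr0.ne')
  have hr1 : S.τ * 0 < ‖r₀‖ := by rwa [mul_zero]
  by_cases hg₀ : g₀ = 0
  · rw [stepSize, if_pos hr1, if_pos hg₀]
    refine (tendsto_const_nhds.mul (hpow (2 - S.q / 2))).congr' ?_
    have hsm : ∀ᶠ δ in 𝓝[>] (0 : ℝ), S.μ₁ * ‖g δ‖ ^ 2
        < S.μ₀ * ‖r δ‖ ^ (2 * (S.q / 2 - 1)) := by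
      refine (tendsto_const_nhds.mul (hg.norm.pow 2)).eventually_lt
        (tendsto_const_nhds.mul (hpow _)) ?_
      rw [hg₀, norm_zero, zero_pow two_ne_zero, mul_zero]
      positivity
    filter_upwards [hev, hsm] with δ h1 h2
    rw [stepSize, if_pos h1]
    by_cases hgδ : g δ = 0
    · rw [if_pos hgδ]
    · have : 0 < ‖g δ‖ := norm_pos_iff.2 hgδ
      rw [if_neg hgδ, min_eq_right]
      rw [le_div_iff₀ (by positivity)]
      exact h2.le
  · have hg0 : 0 < ‖g₀‖ := norm_pos_iff.2 hg₀
    rw [stepSize, if_pos hr1, if_neg hg₀]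
    have hne : ∀ᶠ δ in 𝓝[>] (0 : ℝ), g δ ≠ 0 := hg.eventually_ne hg₀
    refine Tendsto.congr' ?_ ((((tendsto_const_nhds.mul (hpow (2 * (S.q / 2 - 1)))).div
      (hg.norm.pow 2) (by positivity)).min tendsto_const_nhds).mul (hpow (2 - S.q / 2)))
    filter_upwards [hev, hne] with δ h1 h2
    rw [stepSize, if_pos h1, if_neg h2]
    rfl

theorem stepSize_zero_zero (i : Fin I) (g : X) : S.stepSize 0 (0 : Y i) g = 0 :=
  stepSize_of_le (by simp)

/-- When the limit residual is zero, the noisy residuals may lie on either side of the threshold.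
The update tends to zero regardless, since its norm is at most `C μ₁ ‖r‖`. -/
theorem tendsto_stepSize_smul (h : S.Standing y c₀ ρ C η ν) {i : Fin I}
    {x : ℝ → X} {x₀ : X} {r : ℝ → Y i} {r₀ : Y i} (hx : Tendsto x (𝓝[>] (0 : ℝ)) (𝓝 x₀))
    (hx₀ : x₀ ∈ Metric.ball S.σ₀ (3 * ρ)) (hr : Tendsto r (𝓝[>] (0 : ℝ)) (𝓝 r₀)) :
    Tendsto (fun δ => S.stepSize δ (r δ) (S.adjDual i (x δ) (r δ)) • S.adjDual i (x δ) (r δ))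
      (𝓝[>] (0 : ℝ)) (𝓝 (S.stepSize 0 r₀ (S.adjDual i x₀ r₀) • S.adjDual i x₀ r₀)) := by
  by_cases hr₀ : r₀ = 0
  · subst hr₀
    rw [stepSize_zero_zero, zero_smul]
    have hlim : Tendsto (fun δ => C * S.μ₁ * ‖r δ‖) (𝓝[>] (0 : ℝ)) (𝓝 (C * S.μ₁ * ‖(0 : Y i)‖)) :=
      tendsto_const_nhds.mul hr.norm
    rw [norm_zero, mul_zero] at hlim
    refine squeeze_zero_norm' ?_ hlim
    filter_upwards [hx.eventually (Metric.isOpen_ball.mem_nhds hx₀), self_mem_nhdsWithin]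
      with δ h1 h2
    have hδ : (0 : ℝ) ≤ δ := le_of_lt h2
    rw [norm_smul, Real.norm_of_nonneg (h.stepSize_nonneg hδ _ _)]
    exact h.stepSize_mul_norm_le hδ (h.norm_adjDual_le i h1 _)
  · have hg := h.tendsto_adjDual hx hx₀ hr hr₀
    exact (h.tendsto_stepSize hr hr₀ hg).smul hg

theorem tendsto_stepSize_mul_rpow (h : S.Standing y c₀ ρ C η ν) {i : Fin I}
    {x : ℝ → X} {x₀ : X} {r : ℝ → Y i} {r₀ : Y i} (hx : Tendsto x (𝓝[>] (0 : ℝ)) (𝓝 x₀))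
    (hx₀ : x₀ ∈ Metric.ball S.σ₀ (3 * ρ)) (hr : Tendsto r (𝓝[>] (0 : ℝ)) (𝓝 r₀)) :
    Tendsto (fun δ => S.stepSize δ (r δ) (S.adjDual i (x δ) (r δ)) * ‖r δ‖ ^ (S.q / 2))
      (𝓝[>] (0 : ℝ)) (𝓝 (S.stepSize 0 r₀ (S.adjDual i x₀ r₀) * ‖r₀‖ ^ (S.q / 2))) := by
  by_cases hr₀ : r₀ = 0
  · subst hr₀
    rw [stepSize_zero_zero, zero_mul]
    have hlim : Tendsto (fun δ => S.μ₁ * ‖r δ‖ ^ 2) (𝓝[>] (0 : ℝ)) (𝓝 (S.μ₁ * ‖(0 : Y i)‖ ^ 2)) :=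
      tendsto_const_nhds.mul (hr.norm.pow 2)
    rw [norm_zero, zero_pow two_ne_zero, mul_zero] at hlim
    refine squeeze_zero' ?_ ?_ hlim
    · filter_upwards [self_mem_nhdsWithin] with δ h2
      exact mul_nonneg (h.stepSize_nonneg (le_of_lt h2) _ _)
        (Real.rpow_nonneg (norm_nonneg _) _)
    · filter_upwards [self_mem_nhdsWithin] with δ h2
      exact h.stepSize_mul_rpow_le (le_of_lt h2) _ _
  · have hg := h.tendsto_adjDual hx hx₀ hr hr₀
    exact (h.tendsto_stepSize hr hr₀ hg).mul
      (hr.norm.rpow_const (Or.inl (norm_ne_zero_iff.2 hr₀)))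

end Standing

/-- Admissible runs for all noise levels, together with combination parameters for exact data to
which their combination parameters converge wherever that matters. -/
structure IsNoisyFamily (S : TPGSetup X Y) (y : ∀ i, Y i) (c₀ ρ η ν : ℝ) (yδ : ℝ → ∀ i, Y i)
    (lamδ : ℝ → ℕ → Fin I → ℝ) (lam : ℕ → Fin I → ℝ) : Prop where
  run : ∀ δ : ℝ, 0 < δ → S.IsAdmissibleRun y c₀ ρ η ν (yδ δ) δ (lamδ δ)
  bdd : ∀ n i, ∃ B : ℝ, ∀ᶠ δ in 𝓝[>] (0 : ℝ), lamδ δ n i ≤ B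
  lim : ∀ n (i : Fin I), S.momentum y 0 lam n i ≠ 0 →
      Tendsto (fun δ => lamδ δ n i) (𝓝[>] (0 : ℝ)) (𝓝 (lam n i))

namespace IsNoisyFamily

variable {S : TPGSetup X Y} {y : ∀ i, Y i} {c₀ ρ C η ν : ℝ} {yδ : ℝ → ∀ i, Y i}
    {lamδ : ℝ → ℕ → Fin I → ℝ} {lam : ℕ → Fin I → ℝ}

theorem tendsto_data (F : S.IsNoisyFamily y c₀ ρ η ν yδ lamδ lam) (i : Fin I) :
    Tendsto (fun δ => yδ δ i) (𝓝[>] (0 : ℝ)) (𝓝 (y i)) := by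
  refine tendsto_iff_norm_sub_tendsto_zero.2 ?_
  refine squeeze_zero' (Eventually.of_forall fun _ => norm_nonneg _) ?_
    (tendsto_id.mono_left (nhdsWithin_le_nhds (s := Set.Ioi (0 : ℝ))))
  filter_upwards [self_mem_nhdsWithin] with δ hδ
  rw [norm_sub_rev]
  exact (F.run δ hδ).noise i

variable {n : ℕ} {i : Fin I}

/-- Where the limit momentum vanishes the combination parameters need not converge; boundedness
suffices for the product. -/
theorem tendsto_smul_momentum (F : S.IsNoisyFamily y c₀ ρ η ν yδ lamδ lam)
    (ht : Tendsto (fun δ => S.momentum (yδ δ) δ (lamδ δ) n i) (𝓝[>] (0 : ℝ))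
      (𝓝 (S.momentum y 0 lam n i))) :
    Tendsto (fun δ => lamδ δ n i • S.momentum (yδ δ) δ (lamδ δ) n i) (𝓝[>] (0 : ℝ))
      (𝓝 (lam n i • S.momentum y 0 lam n i)) := by
  by_cases hm : S.momentum y 0 lam n i = 0
  · obtain ⟨B, hB⟩ := F.bdd n i
    rw [hm] at ht ⊢
    rw [smul_zero]
    have hlim := (tendsto_const_nhds (x := B)).mul ht.norm
    rw [norm_zero, mul_zero] at hlim
    refine squeeze_zero_norm' ?_ hlim
    filter_upwards [hB, self_mem_nhdsWithin] with δ h1 h2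
    rw [norm_smul, Real.norm_of_nonneg ((F.run δ h2).params.nonneg n i)]
    gcongr
  · exact (F.lim n i hm).smul ht

theorem tendsto_momentum
    (ht : Tendsto (fun δ => S.iter (yδ δ) δ (lamδ δ) (n * I + i)) (𝓝[>] (0 : ℝ))
      (𝓝 (S.iter y 0 lam (n * I + i)))) :
    Tendsto (fun δ => S.momentum (yδ δ) δ (lamδ δ) n i) (𝓝[>] (0 : ℝ))
      (𝓝 (S.momentum y 0 lam n i)) :=
  ((continuous_fst.tendsto _).comp ht).sub ((continuous_snd.tendsto _).comp ht)

theorem tendsto_z (F : S.IsNoisyFamily y c₀ ρ η ν yδ lamδ lam) (h : S.Standing y c₀ ρ C η ν)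
    (ht : Tendsto (fun δ => S.iter (yδ δ) δ (lamδ δ) (n * I + i)) (𝓝[>] (0 : ℝ))
      (𝓝 (S.iter y 0 lam (n * I + i)))) :
    Tendsto (fun δ => S.zeta (yδ δ) δ (lamδ δ) n i) (𝓝[>] (0 : ℝ)) (𝓝 (S.zeta y 0 lam n i)) ∧
    Tendsto (fun δ => S.z (yδ δ) δ (lamδ δ) n i) (𝓝[>] (0 : ℝ)) (𝓝 (S.z y 0 lam n i)) ∧
    S.z y 0 lam n i ∈ Metric.ball S.σ₀ (3 * ρ) ∧
    Tendsto (fun δ => S.residual (yδ δ) δ (lamδ δ) n i) (𝓝[>] (0 : ℝ))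
      (𝓝 (S.residual y 0 lam n i)) := by
  have hζ : Tendsto (fun δ => S.zeta (yδ δ) δ (lamδ δ) n i) (𝓝[>] (0 : ℝ))
      (𝓝 (S.zeta y 0 lam n i)) :=
    ((continuous_fst.tendsto _).comp ht).add (F.tendsto_smul_momentum (tendsto_momentum ht))
  have hz : Tendsto (fun δ => S.z (yδ δ) δ (lamδ δ) n i) (𝓝[>] (0 : ℝ))
      (𝓝 (S.z y 0 lam n i)) := (h.penalty.continuous_argminTilt.tendsto _).comp hζ
  have hball : S.z y 0 lam n i ∈ Metric.ball S.σ₀ (3 * ρ) := by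
    have h1 : ‖S.z y 0 lam n i - S.σ₀‖ ≤ 5 / 2 * ρ := by
      refine le_of_tendsto (hz.sub_const S.σ₀).norm ?_
      filter_upwards [self_mem_nhdsWithin] with δ hδ
      exact (F.run δ hδ).norm_z_sub_le h n i
    have hρ := h.op.rho_pos
    rw [Metric.mem_ball, dist_eq_norm]
    linarith
  refine ⟨hζ, hz, hball, ?_⟩
  exact ((h.op.differentiable i _ hball).continuousAt.tendsto.comp hz).sub (F.tendsto_data i)

/-- For each fixed index the iterates depend continuously on the data as the noise vanishes. -/
theorem tendsto_iter (F : S.IsNoisyFamily y c₀ ρ η ν yδ lamδ lam)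
    (h : S.Standing y c₀ ρ C η ν) (m : ℕ) :
    Tendsto (fun δ => S.iter (yδ δ) δ (lamδ δ) m) (𝓝[>] (0 : ℝ)) (𝓝 (S.iter y 0 lam m)) := by
  induction m with
  | zero => exact tendsto_const_nhds
  | succ m ih =>
    obtain ⟨n, i, rfl⟩ := exists_index I m
    obtain ⟨hζ, hz, hball, hr⟩ := F.tendsto_z h ih
    simp only [iter_succ]
    exact (hζ.sub (h.tendsto_stepSize_smul hz hball hr)).prodMk_nhds
      ((continuous_fst.tendsto _).comp ih)

/-- The exact run is admissible, provided that its combination parameters are chosen nonnegative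
where the momentum vanishes. -/
theorem isAdmissibleRun (F : S.IsNoisyFamily y c₀ ρ η ν yδ lamδ lam)
    (h : S.Standing y c₀ ρ C η ν)
    (h0 : ∀ n (i : Fin I), S.momentum y 0 lam n i = 0 → lam n i = 0) :
    S.IsAdmissibleRun y c₀ ρ η ν y 0 lam := by
  have hlim : ∀ n (i : Fin I), Tendsto (fun δ => (lamδ δ n i ^ 2 + lamδ δ n i) / (4 * c₀)
      * ‖S.momentum (yδ δ) δ (lamδ δ) n i‖ ^ 2) (𝓝[>] (0 : ℝ))
      (𝓝 ((lam n i ^ 2 + lam n i) / (4 * c₀) * ‖S.momentum y 0 lam n i‖ ^ 2)) := by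
    intro n i
    have hm := tendsto_momentum (F.tendsto_iter h (n * I + i))
    -- Rewritten so that `l` enters only through `l • v`, which converges even where `l` itself does
    -- not.
    have e : ∀ (l : ℝ) (v : X), (l ^ 2 + l) / (4 * c₀) * ‖v‖ ^ 2
        = (‖l • v‖ ^ 2 + inner ℝ (l • v) v) / (4 * c₀) := by
      intro l v
      rw [norm_smul, mul_pow, Real.norm_eq_abs, sq_abs, real_inner_smul_left,
        real_inner_self_eq_norm_sq]
      ring
    simp only [e]
    have h1 := F.tendsto_smul_momentum hm
    exact ((h1.norm.pow 2).add (h1.inner hm)).div_const _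
  refine ⟨le_rfl, fun i => by simp, fun n i => ?_, fun n i => ?_, fun n i => ?_⟩
  · by_cases hm : S.momentum y 0 lam n i = 0
    · rw [h0 n i hm]
    · refine ge_of_tendsto (F.lim n i hm) ?_
      filter_upwards [self_mem_nhdsWithin] with δ hδ
      exact (F.run δ hδ).params.nonneg n i
  · refine le_of_tendsto (hlim n i) ?_
    filter_upwards [self_mem_nhdsWithin] with δ hδ
    exact (F.run δ hδ).params.le_radius n i
  · obtain ⟨hζ, hz, hball, hr⟩ := F.tendsto_z h (F.tendsto_iter h (n * I + i))
    have h2 := (hlim n i).sub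
      ((h.tendsto_stepSize_mul_rpow hz hball hr).const_mul (S.c₁ c₀ η / ν))
    simp only [← mul_assoc] at h2
    refine le_of_tendsto h2 ?_
    filter_upwards [self_mem_nhdsWithin] with δ hδ
    exact (F.run δ hδ).params.le_residual n i

end IsNoisyFamily

end TPGSetup

/-! ### Convergence of the exact run along record residuals. -/

theorem frequently_forall_le_of_tendsto_zero {u : ℕ → ℝ} (hnn : ∀ n, 0 ≤ u n)
    (hlim : Tendsto u atTop (𝓝 0)) (hzero : ∀ n m, n ≤ m → u n = 0 → u m = 0) :
    ∃ᶠ k in atTop, ∀ n, n ≤ k → u k ≤ u n := by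
  by_cases h : ∃ n, u n = 0
  · obtain ⟨n, hn⟩ := h
    refine Eventually.frequently ?_
    filter_upwards [eventually_ge_atTop n] with k hk m _
    rw [hzero n k hk hn]
    exact hnn m
  · have hpos : ∀ n, 0 < u n := fun n => (hnn n).lt_of_ne fun h0 => h ⟨n, h0.symm⟩
    have hlog : Tendsto (fun n => Real.log (u n)) atTop atBot :=
      Real.tendsto_log_nhdsGT_zero.comp
        (tendsto_nhdsWithin_iff.2 ⟨hlim, Eventually.of_forall hpos⟩)
    refine (frequently_low_scores hlog).mono fun k hk n hn => ?_
    rcases hn.eq_or_lt with rfl | hlt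
    · exact le_rfl
    · exact ((Real.log_lt_log_iff (hpos k) (hpos n)).1 (hk n hlt)).le

namespace TPGSetup

variable {X : Type*} [NormedAddCommGroup X] [InnerProductSpace ℝ X] [CompleteSpace X]
  {I : ℕ} [NeZero I] {Y : Fin I → Type*} [∀ i, NormedAddCommGroup (Y i)]
  [∀ i, NormedSpace ℝ (Y i)]

/-- The sum of the residual norms over one outer step. -/
noncomputable def resSum (S : TPGSetup X Y) (data : ∀ i, Y i) (δ : ℝ) (lam : ℕ → Fin I → ℝ)
    (n : ℕ) : ℝ :=
  ∑ i, ‖S.residual data δ lam n i‖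

theorem resSum_nonneg (S : TPGSetup X Y) (data : ∀ i, Y i) (δ : ℝ) (lam : ℕ → Fin I → ℝ)
    (n : ℕ) : 0 ≤ S.resSum data δ lam n :=
  Finset.sum_nonneg fun _ _ => norm_nonneg _

theorem residual_le_resSum (S : TPGSetup X Y) (data : ∀ i, Y i) (δ : ℝ) (lam : ℕ → Fin I → ℝ)
    (n : ℕ) (i : Fin I) : ‖S.residual data δ lam n i‖ ≤ S.resSum data δ lam n :=
  Finset.single_le_sum (f := fun i => ‖S.residual data δ lam n i‖)
    (fun _ _ => norm_nonneg _) (Finset.mem_univ i)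

namespace Standing

variable {S : TPGSetup X Y} {y : ∀ i, Y i} {c₀ ρ C η ν : ℝ}

theorem norm_fderiv_sub_le (h : S.Standing y c₀ ρ C η ν) (i : Fin I) {x x' : X}
    (hx : x ∈ Metric.ball S.σ₀ (3 * ρ)) (hx' : x' ∈ Metric.ball S.σ₀ (3 * ρ)) :
    ‖fderiv ℝ (S.H i) x' (x - x')‖ ≤ (1 + η) * ‖S.H i x - S.H i x'‖ := by
  have h1 := h.op.tangential_cone i x hx x' hx'
  have h2 := norm_sub_norm_le (fderiv ℝ (S.H i) x' (x - x')) (S.H i x - S.H i x')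
  rw [norm_sub_rev] at h1
  linarith

theorem norm_H_sub_le (h : S.Standing y c₀ ρ C η ν) (i : Fin I) {x x' : X}
    (hx : x ∈ Metric.ball S.σ₀ (3 * ρ)) (hx' : x' ∈ Metric.ball S.σ₀ (3 * ρ)) :
    ‖S.H i x - S.H i x'‖ ≤ C / (1 - η) * ‖x - x'‖ := by
  have h1 := h.op.tangential_cone i x hx x' hx'
  have h2 := norm_sub_norm_le (S.H i x - S.H i x') (fderiv ℝ (S.H i) x' (x - x'))
  have h3 := (fderiv ℝ (S.H i) x').le_of_opNorm_le (h.op.deriv_bound i x' hx') (x - x')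
  have hη : 0 < 1 - η := by linarith [h.op.eta_lt_one]
  rw [div_mul_eq_mul_div, le_div_iff₀ hη]
  linarith

end Standing

namespace IsAdmissibleRun

variable {S : TPGSetup X Y} {y : ∀ i, Y i} {c₀ ρ C η ν : ℝ} {data : ∀ i, Y i}
    {δ : ℝ} {lam : ℕ → Fin I → ℝ}

/-- Admissibility bounds `λ² ‖momentum‖²` by a multiple of `μ ‖r‖^(q/2)`, which is at most `μ₁
‖r‖²`. Extrapolations are therefore of the order of the residual. -/
theorem exists_lam_mul_momentum_le (R : S.IsAdmissibleRun y c₀ ρ η ν data δ lam)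
    (h : S.Standing y c₀ ρ C η ν) : ∃ K, 0 ≤ K ∧ ∀ n i,
      lam n i * ‖S.momentum data δ lam n i‖ ≤ K * ‖S.residual data δ lam n i‖ := by
  have hc := h.c₀_pos
  have hc₁ := h.c₁_pos
  have hν : 0 < ν := zero_lt_one.trans h.one_lt_ν
  have hμ₁ := h.μ₁_pos
  have hA : 0 ≤ 4 * c₀ * (S.c₁ c₀ η / ν * S.μ₁) := by positivity
  refine ⟨√(4 * c₀ * (S.c₁ c₀ η / ν * S.μ₁)), Real.sqrt_nonneg _, fun n i => ?_⟩
  refine le_of_sq_le_sq ?_ (by positivity)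
  rw [mul_pow _ ‖S.residual data δ lam n i‖, Real.sq_sqrt hA]
  have h1 := R.params.le_residual n i
  have h2 := R.params.nonneg n i
  have h3 : S.mu data δ lam n i * ‖S.residual data δ lam n i‖ ^ (S.q / 2)
      ≤ S.μ₁ * ‖S.residual data δ lam n i‖ ^ 2 :=
    h.stepSize_mul_rpow_le R.δ_nonneg _ _
  have h4 : S.c₁ c₀ η / ν * (S.mu data δ lam n i * ‖S.residual data δ lam n i‖ ^ (S.q / 2))
      ≤ S.c₁ c₀ η / ν * (S.μ₁ * ‖S.residual data δ lam n i‖ ^ 2) := by gcongr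
  have h5 : (lam n i ^ 2 + lam n i) * ‖S.momentum data δ lam n i‖ ^ 2
      ≤ S.c₁ c₀ η / ν * (S.μ₁ * ‖S.residual data δ lam n i‖ ^ 2) * (4 * c₀) := by
    rw [← div_le_iff₀ (by positivity)]
    have e : (lam n i ^ 2 + lam n i) * ‖S.momentum data δ lam n i‖ ^ 2 / (4 * c₀)
        = (lam n i ^ 2 + lam n i) / (4 * c₀) * ‖S.momentum data δ lam n i‖ ^ 2 := by ring
    rw [e]
    linarith
  have h6 : 0 ≤ lam n i * ‖S.momentum data δ lam n i‖ ^ 2 := by positivity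
  nlinarith

theorem exists_norm_increment_le (R : S.IsAdmissibleRun y c₀ ρ η ν data δ lam)
    (h : S.Standing y c₀ ρ C η ν) : ∃ K, 0 ≤ K ∧ ∀ n (i : Fin I),
      ‖S.zeta data δ lam n i - S.xi data δ lam n i‖ ≤ K * ‖S.residual data δ lam n i‖ ∧
      ‖S.xi data δ lam n (i + 1) - S.xi data δ lam n i‖
        ≤ K * ‖S.residual data δ lam n i‖ := by
  obtain ⟨K, hK, hle⟩ := R.exists_lam_mul_momentum_le h
  have hμ₁ := h.μ₁_pos
  have hC := h.C_nonneg
  refine ⟨K + C * S.μ₁, by positivity, fun n i => ?_⟩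
  have h1 : ‖S.zeta data δ lam n i - S.xi data δ lam n i‖
      ≤ K * ‖S.residual data δ lam n i‖ := by
    rw [zeta, add_sub_cancel_left, norm_smul, Real.norm_of_nonneg (R.params.nonneg n i)]
    exact hle n i
  have h2 : 0 ≤ C * S.μ₁ * ‖S.residual data δ lam n i‖ := by positivity
  have h3 : S.mu data δ lam n i * ‖S.adjDual i (S.z data δ lam n i) (S.residual data δ lam n i)‖
      ≤ C * S.μ₁ * ‖S.residual data δ lam n i‖ :=
    h.stepSize_mul_norm_le R.δ_nonneg (h.norm_adjDual_le i (R.z_mem_ball h n i) _)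
  rw [add_mul]
  refine ⟨by linarith, ?_⟩
  rw [xi_succ, sub_right_comm]
  refine (norm_sub_le _ _).trans (add_le_add h1 ?_)
  rwa [norm_smul, Real.norm_of_nonneg (R.mu_nonneg h n i)]

theorem exists_norm_zeta_sub_le (R : S.IsAdmissibleRun y c₀ ρ η ν data δ lam)
    (h : S.Standing y c₀ ρ C η ν) : ∃ K, 0 ≤ K ∧ ∀ n (i : Fin I),
      ‖S.xi data δ lam n 0 - S.zeta data δ lam n i‖ ≤ K * S.resSum data δ lam n := by
  obtain ⟨K, hK, hle⟩ := R.exists_norm_increment_le h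
  have hres : ∀ n (i : Fin I), K * ‖S.residual data δ lam n i‖ ≤ K * S.resSum data δ lam n :=
    fun n i => mul_le_mul_of_nonneg_left (residual_le_resSum S data δ lam n i) hK
  have hxi : ∀ n j, j < I → ‖S.xi data δ lam n j - S.xi data δ lam n 0‖
      ≤ j * (K * S.resSum data δ lam n) := by
    intro n j
    induction j with
    | zero => simp
    | succ j ih =>
      intro hj
      have hj' : j < I := Nat.lt_of_succ_lt hj
      have h1 := ih hj'
      have h2 := (hle n ⟨j, hj'⟩).2.trans (hres n _)
      change ‖S.xi data δ lam n (j + 1) - S.xi data δ lam n j‖ ≤ _ at h2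
      have h3 := norm_sub_le_norm_sub_add_norm_sub (S.xi data δ lam n (j + 1))
        (S.xi data δ lam n j) (S.xi data δ lam n 0)
      push_cast
      linarith
  refine ⟨(I + 1) * K, by positivity, fun n i => ?_⟩
  have h1 := hxi n i i.isLt
  have h2 := (hle n i).1.trans (hres n i)
  have h3 := norm_sub_le_norm_sub_add_norm_sub (S.zeta data δ lam n i)
        (S.xi data δ lam n i) (S.xi data δ lam n 0)
  have h4 : ((i : ℕ) : ℝ) * (K * S.resSum data δ lam n) ≤ I * (K * S.resSum data δ lam n) := by
    have : ((i : ℕ) : ℝ) ≤ I := by exact_mod_cast i.isLt.le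
    have := resSum_nonneg S data δ lam n
    gcongr
  rw [norm_sub_rev]
  linarith

theorem norm_sub_sigma_le (R : S.IsAdmissibleRun y c₀ ρ η ν data δ lam)
    (h : S.Standing y c₀ ρ C η ν) {w : X} (hw : S.IsLocalSolution y ρ w)
    (hD : bregReal S.Θ S.ξ₀ w ≤ c₀ * ρ ^ 2) (n : ℕ) : ‖w - S.sigma data δ lam n 0‖ ≤ ρ := by
  have h1 : bregReal S.Θ (S.xi data δ lam n 0) w ≤ bregReal S.Θ (S.xi data δ lam 0 0) w :=
    R.antitone_bregReal h hw (Nat.zero_le n)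
  rw [xi_zero_zero] at h1
  have h2 := h.penalty.norm_sq_le_bregReal (S.xi data δ lam n 0) hw.mem_effDom
  exact le_of_sq_le_sq (le_of_mul_le_mul_left ((h2.trans h1).trans hD) h.c₀_pos)
    h.op.rho_pos.le

theorem sigma_mem_ball (R : S.IsAdmissibleRun y c₀ ρ η ν data δ lam)
    (h : S.Standing y c₀ ρ C η ν) (n : ℕ) :
    S.sigma data δ lam n 0 ∈ Metric.ball S.σ₀ (3 * ρ) := by
  obtain ⟨w, hw, hD, hwρ⟩ := h.exists_solution
  have h1 := R.norm_sub_sigma_le h hw hD n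
  have h2 := norm_sub_le_norm_sub_add_norm_sub (S.sigma data δ lam n 0) w S.σ₀
  have hρ := h.op.rho_pos
  rw [norm_sub_rev _ w] at h2
  rw [Metric.mem_ball, dist_eq_norm]
  linarith

/-- Each residual is measured at its own `z`. Within one outer step these points lie within a
multiple of the residual sum from `σ_n`, so all equations can be compared at the common point `σ_n`.
-/
theorem exists_norm_H_sigma_sub_le {lam : ℕ → Fin I → ℝ}
    (R : S.IsAdmissibleRun y c₀ ρ η ν y 0 lam)
    (h : S.Standing y c₀ ρ C η ν) : ∃ K, 0 ≤ K ∧ ∀ n (i : Fin I),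
      ‖S.H i (S.sigma y 0 lam n 0) - y i‖ ≤ K * S.resSum y 0 lam n := by
  obtain ⟨K, hK, hle⟩ := R.exists_norm_zeta_sub_le h
  have hC := h.C_nonneg
  have hc := h.c₀_pos
  have hη : 0 < 1 - η := by linarith [h.op.eta_lt_one]
  refine ⟨C / (1 - η) * (K / (2 * c₀)) + 1, by positivity, fun n i => ?_⟩
  have h1 := h.norm_H_sub_le i (R.sigma_mem_ball h n) (R.z_mem_ball h n i)
  have h2 : ‖S.sigma y 0 lam n 0 - S.z y 0 lam n i‖
      ≤ ‖S.xi y 0 lam n 0 - S.zeta y 0 lam n i‖ / (2 * c₀) :=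
    h.penalty.norm_argminTilt_sub_le _ _
  have h3 : C / (1 - η) * ‖S.sigma y 0 lam n 0 - S.z y 0 lam n i‖
      ≤ C / (1 - η) * (K * S.resSum y 0 lam n / (2 * c₀)) := by
    gcongr
    refine h2.trans ?_
    gcongr
    exact hle n i
  have h4 := residual_le_resSum S y 0 lam n i
  have h5 := norm_sub_le_norm_sub_add_norm_sub (S.H i (S.sigma y 0 lam n 0))
    (S.H i (S.z y 0 lam n i)) (y i)
  change ‖S.H i (S.z y 0 lam n i) - y i‖ ≤ _ at h4
  have e : (C / (1 - η) * (K / (2 * c₀)) + 1) * S.resSum y 0 lam n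
      = C / (1 - η) * (K * S.resSum y 0 lam n / (2 * c₀)) + S.resSum y 0 lam n := by ring
  rw [e]
  linarith

/-- The derivative at `z` is applied to `x - w = (x - z) - (w - z)`. The cone condition bounds each
part by differences of values of `H i`, so no distance to `w` enters the gradient term. -/
theorem inner_increment_le {lam : ℕ → Fin I → ℝ}
    (R : S.IsAdmissibleRun y c₀ ρ η ν y 0 lam) (h : S.Standing y c₀ ρ C η ν)
    {w x : X} (hw : S.IsLocalSolution y ρ w) (hx : x ∈ Metric.ball S.σ₀ (3 * ρ))
    (n : ℕ) (i : Fin I) :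
    inner ℝ (S.xi y 0 lam n (i + 1) - S.xi y 0 lam n i) (x - w)
      ≤ lam n i * ‖S.momentum y 0 lam n i‖ * ‖w - x‖ +
        S.μ₁ * ‖S.residual y 0 lam n i‖ *
          ((1 + η) * (2 * ‖S.residual y 0 lam n i‖ + ‖S.H i x - y i‖)) := by
  have hη := h.op.eta_pos
  have hz := R.z_mem_ball h n i
  set z := S.z y 0 lam n i with hzdef
  set r := S.residual y 0 lam n i with hrdef
  have hr : S.H i z - y i = r := rfl
  have hμ := R.mu_nonneg h n i
  have e : S.xi y 0 lam n (i + 1) - S.xi y 0 lam n i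
      = lam n i • S.momentum y 0 lam n i - S.mu y 0 lam n i • S.adjDual i z r := by
    rw [xi_succ, zeta]
    abel
  rw [e, inner_sub_left, real_inner_smul_left _ _ (S.mu y 0 lam n i), Standing.inner_adjDual]
  have h1 : inner ℝ (lam n i • S.momentum y 0 lam n i) (x - w)
      ≤ lam n i * ‖S.momentum y 0 lam n i‖ * ‖w - x‖ := by
    refine (real_inner_le_norm _ _).trans ?_
    rw [norm_smul, Real.norm_of_nonneg (R.params.nonneg n i), norm_sub_rev]
  set A := fderiv ℝ (S.H i) z
  have h2 : ‖A (x - w)‖ ≤ (1 + η) * (2 * ‖r‖ + ‖S.H i x - y i‖) := by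
    have e2 : A (x - w) = A (x - z) - A (w - z) := by
      rw [← map_sub]
      congr 1
      abel
    have h3 := h.norm_fderiv_sub_le i hx hz
    have h4 := h.norm_fderiv_sub_le i hw.mem_ball hz
    rw [hw.eq i, norm_sub_rev (y i), hr] at h4
    have h5 : ‖S.H i x - S.H i z‖ ≤ ‖S.H i x - y i‖ + ‖r‖ := by
      rw [← hr, norm_sub_rev (S.H i z)]
      exact norm_sub_le_norm_sub_add_norm_sub _ _ _
    rw [e2]
    refine (norm_sub_le _ _).trans ?_
    have h6 : (1 + η) * ‖S.H i x - S.H i z‖ ≤ (1 + η) * (‖S.H i x - y i‖ + ‖r‖) := by gcongr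
    linarith
  have h3 : -(S.mu y 0 lam n i * dualityMap (S.q / 2) r (A (x - w)))
      ≤ S.μ₁ * ‖r‖ * ((1 + η) * (2 * ‖r‖ + ‖S.H i x - y i‖)) := by
    have h4 : -(dualityMap (S.q / 2) r (A (x - w)))
        ≤ ‖r‖ ^ (S.q / 2 - 1) * ‖A (x - w)‖ := by
      rw [← (dualityMap_spec h.one_lt_half_q r).1]
      exact (neg_le_abs _).trans ((dualityMap (S.q / 2) r).le_opNorm _)
    have h5 : S.mu y 0 lam n i * ‖r‖ ^ (S.q / 2 - 1) ≤ S.μ₁ * ‖r‖ :=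
      h.stepSize_mul_rpow_sub_one_le le_rfl _ _
    have hμ₁ := h.μ₁_pos
    calc -(S.mu y 0 lam n i * dualityMap (S.q / 2) r (A (x - w)))
        = S.mu y 0 lam n i * -(dualityMap (S.q / 2) r (A (x - w))) := by ring
      _ ≤ S.mu y 0 lam n i * (‖r‖ ^ (S.q / 2 - 1) * ‖A (x - w)‖) := by gcongr
      _ = (S.mu y 0 lam n i * ‖r‖ ^ (S.q / 2 - 1)) * ‖A (x - w)‖ := by ring
      _ ≤ (S.μ₁ * ‖r‖) * ((1 + η) * (2 * ‖r‖ + ‖S.H i x - y i‖)) := by gcongr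
  linarith

/-- The increments of the exact run over outer steps, tested against the distance to a solution at
a later index with the least residuals so far. -/
theorem exists_inner_outer_increment_le {lam : ℕ → Fin I → ℝ}
    (R : S.IsAdmissibleRun y c₀ ρ η ν y 0 lam) (h : S.Standing y c₀ ρ C η ν)
    {w : X} (hw : S.IsLocalSolution y ρ w) (hD : bregReal S.Θ S.ξ₀ w ≤ c₀ * ρ ^ 2) :
    ∃ K, 0 ≤ K ∧ ∀ n k, S.resSum y 0 lam k ≤ S.resSum y 0 lam n →
      inner ℝ (S.xi y 0 lam (n + 1) 0 - S.xi y 0 lam n 0) (S.sigma y 0 lam k 0 - w)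
        ≤ ρ * ∑ i, lam n i * ‖S.momentum y 0 lam n i‖ + K * S.resSum y 0 lam n ^ 2 := by
  obtain ⟨K, hK, hle⟩ := R.exists_norm_H_sigma_sub_le h
  have hη := h.op.eta_pos
  have hμ₁ := h.μ₁_pos
  refine ⟨S.μ₁ * ((1 + η) * (2 + K)), by positivity, fun n k hkn => ?_⟩
  have e : S.xi y 0 lam (n + 1) 0 - S.xi y 0 lam n 0
      = ∑ i : Fin I, (S.xi y 0 lam n (i + 1) - S.xi y 0 lam n i) := by
    rw [xi_succ_zero, ← Finset.sum_range_sub (fun j => S.xi y 0 lam n j) I, Finset.sum_range]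
  have hterm : ∀ i : Fin I,
      inner ℝ (S.xi y 0 lam n (i + 1) - S.xi y 0 lam n i) (S.sigma y 0 lam k 0 - w)
      ≤ ρ * (lam n i * ‖S.momentum y 0 lam n i‖) +
        S.μ₁ * ((1 + η) * (2 + K)) * S.resSum y 0 lam n * ‖S.residual y 0 lam n i‖ := by
    intro i
    refine (R.inner_increment_le h hw (R.sigma_mem_ball h k) n i).trans (add_le_add ?_ ?_)
    · rw [mul_comm ρ]
      exact mul_le_mul_of_nonneg_left (R.norm_sub_sigma_le h hw hD k)
        (mul_nonneg (R.params.nonneg n i) (norm_nonneg _))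
    -- The record property enters here: the equation error at the later `σ_k` is controlled by the
    -- residual sum at `n`, which makes the whole term quadratic in it.
    · have h1 : ‖S.H i (S.sigma y 0 lam k 0) - y i‖ ≤ K * S.resSum y 0 lam n :=
        (hle k i).trans (by gcongr)
      have h2 := residual_le_resSum S y 0 lam n i
      calc S.μ₁ * ‖S.residual y 0 lam n i‖ * ((1 + η) * (2 * ‖S.residual y 0 lam n i‖
              + ‖S.H i (S.sigma y 0 lam k 0) - y i‖))
          ≤ S.μ₁ * ‖S.residual y 0 lam n i‖ * ((1 + η) * (2 * S.resSum y 0 lam n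
              + K * S.resSum y 0 lam n)) := by gcongr
        _ = _ := by ring
  rw [e, sum_inner]
  refine (Finset.sum_le_sum fun i _ => hterm i).trans (le_of_eq ?_)
  rw [Finset.sum_add_distrib, ← Finset.mul_sum, ← Finset.mul_sum]
  change _ + _ * S.resSum y 0 lam n = _
  ring

theorem summable_resSum_sq {lam : ℕ → Fin I → ℝ}
    (R : S.IsAdmissibleRun y c₀ ρ η ν y 0 lam) (h : S.Standing y c₀ ρ C η ν) :
    Summable fun n => S.resSum y 0 lam n ^ 2 := by
  have hκ := h.stepLower_pos
  have hterm : ∀ n (i : Fin I), ‖S.residual y 0 lam n i‖ ^ 2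
      ≤ S.mu y 0 lam n i * ‖S.residual y 0 lam n i‖ ^ (S.q / 2) / S.stepLower C := by
    intro n i
    rw [le_div_iff₀ hκ, mul_comm]
    by_cases hi : S.mu y 0 lam n i = 0
    · have h0 := (R.mu_eq_zero_iff h n i).1 hi
      rw [mul_zero] at h0
      rw [hi, le_antisymm h0 (norm_nonneg _)]
      simp
    · exact R.stepLower_mul_sq_le h hi
  refine Summable.of_nonneg_of_le (fun n => sq_nonneg _) (fun n => ?_)
    ((R.summable_mu_mul_residual h).mul_left ((I : ℝ) / S.stepLower C))
  have h1 := sq_sum_le_card_mul_sum_sq (s := Finset.univ)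
    (f := fun i => ‖S.residual y 0 lam n i‖)
  rw [Finset.card_univ, Fintype.card_fin] at h1
  refine h1.trans ?_
  rw [div_mul_eq_mul_div, mul_div_assoc, Finset.sum_div]
  gcongr with i
  exact hterm n i

theorem tendsto_resSum {lam : ℕ → Fin I → ℝ}
    (R : S.IsAdmissibleRun y c₀ ρ η ν y 0 lam) (h : S.Standing y c₀ ρ C η ν) :
    Tendsto (S.resSum y 0 lam) atTop (𝓝 0) := by
  have h1 := (R.summable_resSum_sq h).tendsto_atTop_zero.sqrt
  rw [Real.sqrt_zero] at h1
  exact h1.congr fun n => Real.sqrt_sq (resSum_nonneg S y 0 lam n)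

theorem resSum_eq_zero_iff {lam : ℕ → Fin I → ℝ}
    (R : S.IsAdmissibleRun y c₀ ρ η ν y 0 lam) (h : S.Standing y c₀ ρ C η ν) (n : ℕ) :
    S.resSum y 0 lam n = 0 ↔ n ∈ S.stopSet y 0 lam := by
  rw [resSum, Finset.sum_eq_zero_iff_of_nonneg fun _ _ => norm_nonneg _]
  refine ⟨fun h0 i => ?_, fun h0 i _ => ?_⟩
  · rw [R.mu_eq_zero_iff h, h0 i (Finset.mem_univ i), mul_zero]
  · have := (R.mu_eq_zero_iff h n i).1 (h0 i)
    rw [mul_zero] at this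
    exact le_antisymm this (norm_nonneg _)

theorem frequently_resSum_le {lam : ℕ → Fin I → ℝ}
    (R : S.IsAdmissibleRun y c₀ ρ η ν y 0 lam) (h : S.Standing y c₀ ρ C η ν) :
    ∃ᶠ k in atTop, ∀ n, n ≤ k → S.resSum y 0 lam k ≤ S.resSum y 0 lam n := by
  refine frequently_forall_le_of_tendsto_zero (resSum_nonneg S y 0 lam) (R.tendsto_resSum h)
    fun n m hnm hn => ?_
  rw [R.resSum_eq_zero_iff h] at hn ⊢
  exact (R.stationary h hn hnm).1

/-- Along indices with the least residuals so far, the Bregman distances between iterates of the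
exact run are controlled by a null sequence. -/
theorem exists_bregReal_sigma_le {lam : ℕ → Fin I → ℝ}
    (R : S.IsAdmissibleRun y c₀ ρ η ν y 0 lam) (h : S.Standing y c₀ ρ C η ν)
    (hsum : Summable fun n : ℕ => ∑ i : Fin I, lam n i * ‖S.momentum y 0 lam n i‖) :
    ∃ e : ℕ → ℝ, Tendsto e atTop (𝓝 0) ∧ ∀ l k, l ≤ k →
      (∀ n, n ≤ k → S.resSum y 0 lam k ≤ S.resSum y 0 lam n) →
      bregReal S.Θ (S.xi y 0 lam l 0) (S.sigma y 0 lam k 0) ≤ e l := by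
  obtain ⟨w, hw, hD, -⟩ := h.exists_solution
  obtain ⟨K, hK, hle⟩ := R.exists_inner_outer_increment_le h hw hD
  set b : ℕ → ℝ := fun n => ρ * ∑ i, lam n i * ‖S.momentum y 0 lam n i‖
    + K * S.resSum y 0 lam n ^ 2 with hb
  have hbs : Summable b := (hsum.mul_left ρ).add ((R.summable_resSum_sq h).mul_left K)
  have hρ := h.op.rho_pos
  have hbnn : ∀ n, 0 ≤ b n := fun n => by
    have : 0 ≤ ∑ i, lam n i * ‖S.momentum y 0 lam n i‖ := Finset.sum_nonneg fun i _ =>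
      mul_nonneg (R.params.nonneg n i) (norm_nonneg _)
    simp only [hb]
    positivity
  set D : ℕ → ℝ := fun n => bregReal S.Θ (S.xi y 0 lam n 0) w with hDdef
  have hanti : Antitone D := R.antitone_bregReal h hw
  have hbdd : BddBelow (Set.range D) :=
    ⟨0, by rintro _ ⟨n, rfl⟩; exact h.penalty.bregReal_nonneg _ hw.mem_effDom⟩
  -- The first summand is the decrease in distance to `w` still to come, the second the tail of the
  -- dominating series. These are the two terms of the three-point identity.
  refine ⟨fun l => (D l - ⨅ n, D n) + (∑' n, b n - ∑ n ∈ Finset.range l, b n), ?_, ?_⟩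
  · have h1 := (tendsto_atTop_ciInf hanti hbdd).sub_const (⨅ n, D n)
    have h2 := hbs.hasSum.tendsto_sum_nat.const_sub (∑' n, b n)
    have h3 := h1.add h2
    rwa [sub_self, sub_self, add_zero] at h3
  · intro l k hlk hk
    have hid := IsPenalty.bregReal_sub_eq (Θ := S.Θ) (S.xi y 0 lam k 0) (S.xi y 0 lam l 0) w
    have hneg : (inner ℝ (S.xi y 0 lam l 0 - S.xi y 0 lam k 0) (w - S.sigma y 0 lam k 0) : ℝ)
        = inner ℝ (S.xi y 0 lam k 0 - S.xi y 0 lam l 0) (S.sigma y 0 lam k 0 - w) := by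
      rw [← neg_sub, inner_neg_left, ← inner_neg_right, neg_sub]
    have htel : (inner ℝ (S.xi y 0 lam k 0 - S.xi y 0 lam l 0) (S.sigma y 0 lam k 0 - w) : ℝ)
        ≤ ∑ n ∈ Finset.Ico l k, b n := by
      rw [← Finset.sum_Ico_sub (fun n => S.xi y 0 lam n 0) hlk, sum_inner]
      refine Finset.sum_le_sum fun n hn => ?_
      exact hle n k (hk n (Finset.mem_Ico.1 hn).2.le)
    rw [Finset.sum_Ico_eq_sub _ hlk] at htel
    have h1 : ⨅ n, D n ≤ D k := ciInf_le hbdd k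
    have h2 := hbs.sum_le_tsum (Finset.range k) fun n _ => hbnn n
    change D l - D k = bregReal S.Θ (S.xi y 0 lam l 0) (S.sigma y 0 lam k 0)
      - inner ℝ (S.xi y 0 lam l 0 - S.xi y 0 lam k 0) (w - S.sigma y 0 lam k 0) at hid
    rw [hneg] at hid
    simp only
    linarith

/-- Convergence of the exact run to a solution. -/
theorem exists_tendsto_bregReal {lam : ℕ → Fin I → ℝ}
    (R : S.IsAdmissibleRun y c₀ ρ η ν y 0 lam) (h : S.Standing y c₀ ρ C η ν)
    (hsum : Summable fun n : ℕ => ∑ i : Fin I, lam n i * ‖S.momentum y 0 lam n i‖) :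
    ∃ σs, S.IsLocalSolution y ρ σs ∧ σs ∈ Metric.ball S.σ₀ (2 * ρ) ∧
      Tendsto (fun n => bregReal S.Θ (S.xi y 0 lam n 0) σs) atTop (𝓝 0) := by
  obtain ⟨e, he, hle⟩ := R.exists_bregReal_sigma_le h hsum
  obtain ⟨φ, hφ, hrec⟩ := extraction_of_frequently_atTop (R.frequently_resSum_le h)
  obtain ⟨w, hw, hD, hwρ⟩ := h.exists_solution
  have hc := h.c₀_pos
  have hρ := h.op.rho_pos
  have heφ : Tendsto (fun l => e (φ l)) atTop (𝓝 0) := he.comp hφ.tendsto_atTop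
  have hleφ : ∀ l k, l ≤ k →
      bregReal S.Θ (S.xi y 0 lam (φ l) 0) (S.sigma y 0 lam (φ k) 0) ≤ e (φ l) :=
    fun l k hlk => hle _ _ (hφ.monotone hlk) (hrec k)
  have hcau : CauchySeq fun k => S.sigma y 0 lam (φ k) 0 := by
    refine Metric.cauchySeq_iff'.2 fun ε hε => ?_
    obtain ⟨N, hN⟩ := (heφ.eventually_lt_const (show 0 < c₀ * ε ^ 2 by positivity)).exists
    refine ⟨N, fun k hk => ?_⟩
    have h1 := h.penalty.norm_sq_le_bregReal (S.xi y 0 lam (φ N) 0)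
      (h.penalty.argminTilt_mem (S.xi y 0 lam (φ k) 0))
    have h2 := (h1.trans (hleφ N k hk)).trans_lt hN
    rw [dist_eq_norm]
    exact lt_of_pow_lt_pow_left₀ 2 hε.le (lt_of_mul_lt_mul_left h2 hc.le)
  obtain ⟨σs, hσs⟩ := cauchySeq_tendsto_of_complete hcau
  have hlim : ∀ l, σs ∈ effDom S.Θ ∧ bregReal S.Θ (S.xi y 0 lam (φ l) 0) σs ≤ e (φ l) := by
    intro l
    refine h.penalty.mem_and_bregReal_le_of_tendsto hσs _ _ ?_
    filter_upwards [eventually_ge_atTop l] with k hk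
    exact ⟨h.penalty.argminTilt_mem _, hleφ l k hk⟩
  have hnorm : Tendsto (fun k => ‖w - S.sigma y 0 lam (φ k) 0‖) atTop (𝓝 ‖w - σs‖) :=
    (hσs.const_sub w).norm
  have hwσ : ‖w - σs‖ ≤ ρ :=
    le_of_tendsto hnorm (Eventually.of_forall fun k => R.norm_sub_sigma_le h hw hD _)
  have htri : ‖σs - S.σ₀‖ ≤ ‖w - σs‖ + ‖w - S.σ₀‖ := by
    have := norm_sub_le_norm_sub_add_norm_sub σs w S.σ₀
    rwa [norm_sub_rev σs w] at this
  have hball : σs ∈ Metric.ball S.σ₀ (3 * ρ) := by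
    rw [Metric.mem_ball, dist_eq_norm]
    linarith
  obtain ⟨K, hK, hKle⟩ := R.exists_norm_H_sigma_sub_le h
  have heq : ∀ i, S.H i σs = y i := by
    intro i
    have h1 : Tendsto (fun k => S.H i (S.sigma y 0 lam (φ k) 0)) atTop (𝓝 (S.H i σs)) :=
      (h.op.differentiable i _ hball).continuousAt.tendsto.comp hσs
    have h2 : Tendsto (fun k => K * S.resSum y 0 lam (φ k)) atTop (𝓝 (K * 0)) :=
      ((R.tendsto_resSum h).comp hφ.tendsto_atTop).const_mul K
    rw [mul_zero] at h2
    refine tendsto_nhds_unique h1 (tendsto_iff_norm_sub_tendsto_zero.2 ?_)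
    exact squeeze_zero (fun _ => norm_nonneg _) (fun k => hKle _ i) h2
  have hsol : S.IsLocalSolution y ρ σs := ⟨(hlim 0).1, heq, hball⟩
  -- Now that `σs` is known to be a solution in the ball, monotonicity upgrades convergence along
  -- the records to the full sequence.
  have hconv : Tendsto (fun n => bregReal S.Θ (S.xi y 0 lam n 0) σs) atTop (𝓝 0) := by
    refine Metric.tendsto_atTop.2 fun ε hε => ?_
    obtain ⟨N, hN⟩ := (heφ.eventually_lt_const hε).exists
    refine ⟨φ N, fun n hn => ?_⟩
    rw [Real.dist_eq, sub_zero, abs_of_nonneg (h.penalty.bregReal_nonneg _ hsol.mem_effDom)]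
    exact ((R.antitone_bregReal h hsol hn).trans (hlim N).2).trans_lt hN
  refine ⟨σs, hsol, ?_, hconv⟩
  rw [Metric.mem_ball, dist_eq_norm]
  -- The triangle inequality alone gives only the closed ball of radius `2ρ`. If the stopping
  -- criterion holds at index `0`, the run never leaves `ξ₀` and `σs = σ₀`. Otherwise the first
  -- outer step strictly decreases the distance to `w`, so that `‖w - σs‖ < ρ`.
  by_cases h0 : 0 ∈ S.stopSet y 0 lam
  · have h1 : bregReal S.Θ S.ξ₀ σs = 0 := by
      refine tendsto_nhds_unique ?_ hconv
      refine tendsto_const_nhds.congr fun n => ?_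
      rw [(R.stationary h h0 (Nat.zero_le n)).2, xi_zero_zero]
    have h2 := h.penalty.norm_sq_le_bregReal S.ξ₀ hsol.mem_effDom
    rw [h1] at h2
    have h3 : ‖σs - S.σ₀‖ ^ 2 ≤ 0 := by
      change c₀ * ‖σs - S.σ₀‖ ^ 2 ≤ 0 at h2
      by_contra hcon
      have := mul_pos hc (not_le.1 hcon)
      linarith
    nlinarith [norm_nonneg (σs - S.σ₀)]
  · obtain ⟨i, hi⟩ := not_forall.1 h0
    have hμ : 0 < S.mu y 0 lam 0 i := lt_of_le_of_ne (R.mu_nonneg h 0 i) (Ne.symm hi)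
    have hr : 0 < ‖S.residual y 0 lam 0 i‖ := by
      rw [R.mu_eq_zero_iff h, not_le, mul_zero] at hi
      exact hi
    have hpos : 0 < ∑ i, S.mu y 0 lam 0 i * ‖S.residual y 0 lam 0 i‖ ^ (S.q / 2) :=
      Finset.sum_pos' (fun j _ => mul_nonneg (R.mu_nonneg h 0 j)
        (Real.rpow_nonneg (norm_nonneg _) _)) ⟨i, Finset.mem_univ i, by positivity⟩
    have hκ : 0 < (1 - 1 / ν) * S.c₁ c₀ η := by
      refine mul_pos ?_ h.c₁_pos
      rw [sub_pos, div_lt_one (zero_lt_one.trans h.one_lt_ν)]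
      exact h.one_lt_ν
    have h1 := R.bregReal_outer_decrease h hw 0
    rw [xi_zero_zero] at h1
    have h2 : bregReal S.Θ (S.xi y 0 lam (0 + 1) 0) w < c₀ * ρ ^ 2 := by
      linarith [mul_pos hκ hpos]
    have h3 : c₀ * ‖w - σs‖ ^ 2 ≤ bregReal S.Θ (S.xi y 0 lam (0 + 1) 0) w := by
      refine le_of_tendsto ((hnorm.pow 2).const_mul c₀) ?_
      filter_upwards [eventually_ge_atTop 1] with k hk
      exact (h.penalty.norm_sq_le_bregReal _ hw.mem_effDom).trans
        (R.antitone_bregReal h hw (hk.trans hφ.le_apply))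
    have h4 : ‖w - σs‖ < ρ :=
      lt_of_pow_lt_pow_left₀ 2 hρ.le (lt_of_mul_lt_mul_left (h3.trans_lt h2) hc.le)
    linarith

end IsAdmissibleRun

end TPGSetup

/-! ### Assembly: from the exact run to the stopped noisy runs. -/

namespace TPGSetup

variable {X : Type*} [NormedAddCommGroup X] [InnerProductSpace ℝ X] [CompleteSpace X]
  {I : ℕ} [NeZero I] {Y : Fin I → Type*} [∀ i, NormedAddCommGroup (Y i)]
  [∀ i, NormedSpace ℝ (Y i)]

/-- The combination parameters are irrelevant where the momentum vanishes. -/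
theorem iter_congr (S : TPGSetup X Y) (data : ∀ i, Y i) (δ : ℝ) {lam lam' : ℕ → Fin I → ℝ}
    (hl : ∀ n (i : Fin I), S.momentum data δ lam n i ≠ 0 → lam' n i = lam n i) (m : ℕ) :
    S.iter data δ lam' m = S.iter data δ lam m := by
  induction m with
  | zero => rfl
  | succ m ih =>
    obtain ⟨n, i, rfl⟩ := exists_index I m
    rw [iter_succ, iter_succ, ih]
    by_cases hm : S.momentum data δ lam n i = 0
    · rw [momentum] at hm
      simp only [step, hm, smul_zero]
    · rw [hl n i hm]

end TPGSetup

theorem mainTheorem1 {X : Type*} [NormedAddCommGroup X] [InnerProductSpace ℝ X] [CompleteSpace X]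
    {I : ℕ} [NeZero I] {Y : Fin I → Type*} [∀ i, NormedAddCommGroup (Y i)]
    [∀ i, NormedSpace ℝ (Y i)] [∀ i, CompleteSpace (Y i)]
    (hY : ∀ i, UniformlySmooth (Y i))
    (S : TPGSetup X Y) (hq : 2 < S.q) (hτ : 1 < S.τ) (hμ₀ : 0 < S.μ₀) (hμ₁ : 0 < S.μ₁)
    -- the penalty functional
    (c₀ : ℝ) (hc₀ : 0 < c₀) (hproper : ProperFun S.Θ) (hlsc : LowerSemicontinuous S.Θ)
    (hconv : StronglyConvexFun c₀ S.Θ)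
    -- the exact data and the operators
    (y : ∀ i, Y i) (ρ C η : ℝ) (hH : S.OperatorAssumption y c₀ ρ C η)
    (hc₁ : 0 < S.c₁ c₀ η)
    -- the noisy data
    (yδ : ℝ → ∀ i, Y i) (hnoise : ∀ δ : ℝ, 0 < δ → ∀ i, ‖y i - yδ δ i‖ ≤ δ)
    -- the combination parameters for noisy data
    (ν : ℝ) (hν : 1 < ν) (lamδ : ℝ → ℕ → Fin I → ℝ)
    (hlamδ : ∀ δ : ℝ, 0 < δ →
      S.AdmissibleParams (yδ δ) δ (lamδ δ) c₀ ρ (S.c₁ c₀ η) ν)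
    -- the combination parameters for exact data, as limits of those for noisy data
    (lam : ℕ → Fin I → ℝ)
    (hlam_bdd : ∀ n i, ∃ B : ℝ, ∀ᶠ δ in 𝓝[>] (0 : ℝ), lamδ δ n i ≤ B)
    (hlam_lim : ∀ n (i : Fin I), S.momentum y 0 lam n i ≠ 0 →
      Tendsto (fun δ => lamδ δ n i) (𝓝[>] (0 : ℝ)) (𝓝 (lam n i)))
    (hlam_sum : Summable fun n : ℕ => ∑ i : Fin I, lam n i * ‖S.momentum y 0 lam n i‖) :
    ∃ N : ℝ → ℕ, (∀ δ : ℝ, 0 < δ → IsLeast (S.stopSet (yδ δ) δ (lamδ δ)) (N δ)) ∧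
      ∃ σs ∈ Metric.ball S.σ₀ (2 * ρ) ∩ effDom S.Θ, (∀ i, S.H i σs = y i) ∧
        Tendsto (fun δ => S.sigma (yδ δ) δ (lamδ δ) (N δ) 0) (𝓝[>] (0 : ℝ)) (𝓝 σs) ∧
        Tendsto (fun δ => bregmanDist S.Θ (S.xi (yδ δ) δ (lamδ δ) (N δ) 0) σs
          (S.sigma (yδ δ) δ (lamδ δ) (N δ) 0)) (𝓝[>] (0 : ℝ)) (𝓝 0) := by
  have h : S.Standing y c₀ ρ C η ν :=
    ⟨hY, hq, hτ, hμ₀, hμ₁, ⟨hc₀, hproper, hlsc, hconv⟩, hH, hc₁, hν⟩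
  classical
  -- Where the momentum vanishes `lam` is unconstrained and could be negative. Setting it to zero
  -- there changes no iterate and makes the exact run admissible.
  set lam' : ℕ → Fin I → ℝ := fun n i => if S.momentum y 0 lam n i = 0 then 0 else lam n i
    with hlam'
  have hne : ∀ n (i : Fin I), S.momentum y 0 lam n i ≠ 0 → lam' n i = lam n i :=
    fun n i hm => if_neg hm
  have hmom : ∀ n (i : Fin I), S.momentum y 0 lam' n i = S.momentum y 0 lam n i := fun n i => by
    rw [TPGSetup.momentum, TPGSetup.momentum, S.iter_congr y 0 hne]
  have F : S.IsNoisyFamily y c₀ ρ η ν yδ lamδ lam' :=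
    ⟨fun δ hδ => ⟨hδ.le, hnoise δ hδ, hlamδ δ hδ⟩, hlam_bdd, fun n i hm => by
      rw [hmom] at hm
      rw [hne n i hm]
      exact hlam_lim n i hm⟩
  have R : S.IsAdmissibleRun y c₀ ρ η ν y 0 lam' :=
    F.isAdmissibleRun h fun n i hm => by
      rw [hmom] at hm
      exact if_pos hm
  have hsum : Summable fun n : ℕ => ∑ i : Fin I, lam' n i * ‖S.momentum y 0 lam' n i‖ := by
    refine hlam_sum.congr fun n => Finset.sum_congr rfl fun i _ => ?_
    rw [hmom]
    by_cases hm : S.momentum y 0 lam n i = 0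
    · rw [hm, norm_zero, mul_zero, mul_zero]
    · rw [hne n i hm]
  obtain ⟨σs, hsol, hball, hexact⟩ := R.exists_tendsto_bregReal h hsum
  have hN : ∀ δ : ℝ, ∃ N : ℕ, 0 < δ → IsLeast (S.stopSet (yδ δ) δ (lamδ δ)) N := by
    intro δ
    by_cases hδ : 0 < δ
    · have hs := (F.run δ hδ).stopSet_nonempty h hδ
      exact ⟨sInf _, fun _ => ⟨Nat.sInf_mem hs, fun n hn => Nat.sInf_le hn⟩⟩
    · exact ⟨0, fun h0 => absurd h0 hδ⟩
  choose N hN using hN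
  have hlim : Tendsto (fun δ => bregReal S.Θ (S.xi (yδ δ) δ (lamδ δ) (N δ) 0) σs)
      (𝓝[>] (0 : ℝ)) (𝓝 0) := by
    refine Metric.tendsto_nhds.2 fun ε hε => ?_
    -- First `n` is fixed by the exact run, then `δ` is made small by stability at that `n`; the
    -- distance at `N δ` is at most the distance at `n`.
    obtain ⟨n, hn⟩ := (hexact.eventually_lt_const hε).exists
    have hcont : Tendsto (fun δ => bregReal S.Θ (S.xi (yδ δ) δ (lamδ δ) n 0) σs)
        (𝓝[>] (0 : ℝ)) (𝓝 (bregReal S.Θ (S.xi y 0 lam' n 0) σs)) :=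
      ((h.penalty.continuous_bregReal σs).tendsto _).comp
        ((continuous_fst.tendsto _).comp (F.tendsto_iter h (n * I + 0)))
    filter_upwards [hcont.eventually_lt_const hn, self_mem_nhdsWithin] with δ h1 hδ
    rw [Real.dist_eq, sub_zero, abs_of_nonneg (h.penalty.bregReal_nonneg _ hsol.mem_effDom)]
    exact ((F.run δ hδ).bregReal_stop_le h hsol (hN δ hδ).1 n).trans_lt h1
  refine ⟨N, hN, σs, ⟨hball, hsol.mem_effDom⟩, hsol.eq, ?_, ?_⟩
  · refine tendsto_iff_norm_sub_tendsto_zero.2 ?_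
    have h1 := (hlim.div_const c₀).sqrt
    rw [zero_div, Real.sqrt_zero] at h1
    refine squeeze_zero (fun _ => norm_nonneg _) (fun δ => ?_) h1
    refine Real.le_sqrt_of_sq_le ?_
    rw [le_div_iff₀ hc₀, norm_sub_rev, mul_comm]
    exact h.penalty.norm_sq_le_bregReal _ hsol.mem_effDom
  · simp only [TPGSetup.sigma, h.penalty.bregmanDist_eq _ hsol.mem_effDom]
    exact EReal.tendsto_coe.2 hlim
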